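/- Let $X$ be a complex Banach space with open unit ball $B_X$. A set $A\subseteq B_X$ is called $B_X$-bounded if it is bounded and has positive distance to the boundary of $B_X$. Let $H_b(B_X)$ be the space of all holomorphic (that is, complex Fréchet differentiable) functions $f:B_X\to\mathbb{C}$ that are bounded on every $B_X$-bounded set, with the topology of uniform convergence on $B_X$-bounded sets. Every holomorphic map $\varphi:B_X\to B_X$ defines a continuous linear operator $C_\varphi$ on $H_b(B_X)$ by $C_\varphi f=f\circ\varphi$. The map $\varphi$ has $B_X$-stable orbits if for every $B_X$-bounded set $A$ there is a $B_X$-bounded set $L$ such that $\varphi^n(A)\subseteq L$ for all $n\ge 0$. A continuous linear operator $T$ on a locally convex Hausdorff space $E$ is power bounded if $\{T^n: n\ge 0\}$ is equicontinuous, and mean ergodic if there is a continuous linear operator $L$ on $E$ such that $\frac1n\sum_{k=0}^{n-1}T^kx\to Lx$ in $E$ for every $x\in E$. Let $\mathcal{P}(X)$ be the set of continuous polynomials $X\to\mathbb{C}$, i.e. finite sums of functions $x\mapsto L_k(x,\dots,x)$ with $L_k$ a continuous $k$-linear form on $X$ ($k\ge 0$), and let $\sigma(X,\mathcal{P}(X))$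 be the coarsest topology on $X$ making every $P\in\mathcal{P}(X)$ continuous. A subset of $X$ is relatively $\sigma(X,\mathcal{P}(X))$-compact if its closure in this topology is compact. 1. Let $\varphi:B_X\to B_X$ be holomorphic with $B_X$-stable orbits, and suppose that $\varphi(A)$ is relatively $\sigma(X,\mathcal{P}(X))$-compact for every $B_X$-bounded set $A$. Then $C_\varphi:H_b(B_X)\to H_b(B_X)$ is mean ergodic. 2. Suppose that every $B_X$-bounded set is relatively $\sigma(X,\mathcal{P}(X))$-compact. Then for every holomorphic $\varphi:B_X\to B_X$ the operator $C_\varphi:H_b(B_X)\to H_b(B_X)$ is power bounded if and only if it is mean ergodic. -/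

import Mathlib

open Set Filter Topology
open scoped UniformConvergence

noncomputable section

/-! ### Power bounded and mean ergodic operators -/

section Operators

/-- The `n`-th Cesàro mean `(1/n) ∑_{k<n} T^k x` of the orbit of `x` under `T`. -/
def cesaroMean {E : Type*} [AddCommGroup E] [Module ℂ E] [TopologicalSpace E]
    (T : E →L[ℂ] E) (n : ℕ) (x : E) : E :=
  (n : ℂ)⁻¹ • ∑ k ∈ Finset.range n, (T ^ k) x

/-- `T` is power bounded if the family of its iterates `T^n`, `n ≥ 0`, is equicontinuous. -/
def IsPowerBounded {E : Type*} [AddCommGroup E] [Module ℂ E] [UniformSpace E]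
    (T : E →L[ℂ] E) : Prop :=
  Equicontinuous (fun (n : ℕ) (x : E) => (T ^ n) x)

/-- `T` is mean ergodic if its Cesàro means converge pointwise to a continuous linear operator. -/
def IsMeanErgodic {E : Type*} [AddCommGroup E] [Module ℂ E] [TopologicalSpace E]
    (T : E →L[ℂ] E) : Prop :=
  ∃ L : E →L[ℂ] E, ∀ x : E, Tendsto (fun n : ℕ => cesaroMean T n x) atTop (𝓝 (L x))

end Operators

/-! ### Bounded sets, holomorphic maps, and holomorphic functions of bounded type -/

section Holomorphic

variable {X : Type*} [NormedAddCommGroup X] [NormedSpace ℂ X]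

/-- A set `A ⊆ U` is `U`-bounded if it is bounded and has positive distance to the boundary of
`U` (no condition on the distance if the boundary is empty). -/
def IsUBounded {U : Set X} (A : Set U) : Prop :=
  Bornology.IsBounded A ∧
    ∃ δ : ℝ, 0 < δ ∧ ∀ x ∈ A, ∀ y ∈ frontier U, δ ≤ dist (x : X) y

/-- `f : U → U` has `U`-stable orbits if for each `U`-bounded `A` all the iterates `f^n(A)` lie in
one `U`-bounded set. -/
def HasUStableOrbits {U : Set X} (f : U → U) : Prop :=
  ∀ A : Set U, IsUBounded A → ∃ L : Set U, IsUBounded L ∧ ∀ n : ℕ, f^[n] '' A ⊆ L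

/-- A map `f : U → Y` on an open set `U` is holomorphic if it is complex Fréchet differentiable at
each point of `U` (differentiability is expressed through an extension of `f` to `X`). -/
def IsHolomorphic {Y : Type*} [NormedAddCommGroup Y] [NormedSpace ℂ Y] {U : Set X}
    (f : U → Y) : Prop :=
  ∃ g : X → Y, DifferentiableOn ℂ g U ∧ ∀ x : U, g x = f x

/-- The space of holomorphic functions of bounded type `f : U → ℂ` (bounded on `U`-bounded sets),
with the topology of uniform convergence on `U`-bounded sets. -/
def Hb (U : Set X) : Submodule ℂ (U →ᵤ[{A : Set U | IsUBounded A}] ℂ) where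
  carrier := {f | IsHolomorphic (UniformOnFun.toFun {A : Set U | IsUBounded A} f) ∧
    ∀ A : Set U, IsUBounded A →
      Bornology.IsBounded (UniformOnFun.toFun {A : Set U | IsUBounded A} f '' A)}
  zero_mem' := by
    refine ⟨⟨fun _ => 0, differentiableOn_const _, fun _ => rfl⟩, fun A _ => ?_⟩
    refine (Bornology.isBounded_singleton (x := (0 : ℂ))).subset ?_
    rintro _ ⟨x, -, rfl⟩
    rfl
  add_mem' := by
    rintro f₁ f₂ ⟨⟨g₁, hg₁, e₁⟩, b₁⟩ ⟨⟨g₂, hg₂, e₂⟩, b₂⟩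
    refine ⟨⟨g₁ + g₂, hg₁.add hg₂, fun x => ?_⟩, fun A hA => ?_⟩
    · change g₁ x + g₂ x = _
      rw [e₁, e₂]
      rfl
    · refine ((b₁ A hA).add (b₂ A hA)).subset ?_
      rintro _ ⟨x, hx, rfl⟩
      exact Set.add_mem_add (mem_image_of_mem _ hx) (mem_image_of_mem _ hx)
  smul_mem' := by
    rintro c f ⟨⟨g, hg, e⟩, b⟩
    refine ⟨⟨fun x => c • g x, hg.const_smul c, fun x => ?_⟩, fun A hA => ?_⟩
    · change c • g x = _
      rw [e]
      rfl
    · refine ((b A hA).smul₀ c).subset ?_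
      rintro _ ⟨x, hx, rfl⟩
      exact Set.smul_mem_smul_set (mem_image_of_mem _ hx)

end Holomorphic

/-! ### The unit ball and composition operators -/

section Ball

variable {X : Type*} [NormedAddCommGroup X] [NormedSpace ℂ X]

variable (X) in
/-- The open unit ball `B_X`. -/
abbrev unitBall : Set X := Metric.ball (0 : X) 1

/-- Subsets of the ball are `B_X`-bounded exactly when they lie in a smaller ball. -/
theorem isUBounded_unitBall_iff (A : Set (unitBall X)) :
    IsUBounded A ↔ ∃ r : ℝ, 0 ≤ r ∧ r < 1 ∧ ∀ x ∈ A, ‖(x : X)‖ ≤ r := by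
  constructor
  · rintro ⟨-, δ, hδ, h⟩
    refine ⟨max 0 (1 - δ), le_max_left _ _, by simp [hδ], fun x hx => ?_⟩
    by_cases h0 : (x : X) = 0
    · simp [h0]
    have hn : 0 < ‖(x : X)‖ := norm_pos_iff.2 h0
    have hx1 : ‖(x : X)‖ < 1 := mem_ball_zero_iff.1 x.2
    have hy : ((‖(x : X)‖ : ℝ)⁻¹ : ℝ) • (x : X) ∈ frontier (unitBall X) := by
      rw [frontier_ball (0 : X) one_ne_zero]
      simp [norm_smul, hn.ne']
    have := h x hx _ hy
    have e : (x : X) - ((‖(x : X)‖ : ℝ)⁻¹ : ℝ) • (x : X) = (1 - (‖(x : X)‖ : ℝ)⁻¹) • (x : X) := by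
      rw [sub_smul, one_smul]
    rw [dist_eq_norm, e, norm_smul, Real.norm_eq_abs, abs_sub_comm,
      abs_of_nonneg (sub_nonneg.2 ((one_le_inv₀ hn).2 hx1.le)), sub_mul, inv_mul_cancel₀ hn.ne',
      one_mul] at this
    exact le_max_of_le_right (by linarith)
  · rintro ⟨r, -, hr, h⟩
    refine ⟨?_, 1 - r, by linarith, fun x hx y hy => ?_⟩
    · refine Metric.isBounded_iff.2 ⟨2, fun x _ y _ => ?_⟩
      have hx1 : ‖(x : X)‖ < 1 := mem_ball_zero_iff.1 x.2
      have hy1 : ‖(y : X)‖ < 1 := mem_ball_zero_iff.1 y.2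
      have := norm_sub_le (x : X) (y : X)
      rw [Subtype.dist_eq, dist_eq_norm]
      linarith
    · have hy1 : (1 : ℝ) ≤ ‖y‖ := by
        have : y ∉ unitBall X := by
          have := (Metric.isOpen_ball (x := (0 : X)) (ε := 1)).inter_frontier_eq
          intro hyb
          exact (this ▸ (⟨hyb, hy⟩ : y ∈ unitBall X ∩ frontier (unitBall X)) : y ∈ (∅ : Set X))
        simpa using this
      have h1 := norm_sub_norm_le y (x : X)
      have h2 := h x hx
      rw [dist_comm, dist_eq_norm]
      linarith

/-- A Schwarz–Pick estimate: a holomorphic self-map of the ball maps smaller balls into smaller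
balls. -/
theorem one_sub_sq_norm_ge_of_holomorphic (φ : unitBall X → unitBall X)
    (hφ : IsHolomorphic (fun x => (φ x : X))) (x : unitBall X) :
    (1 - ‖(x : X)‖ ^ 2) * (1 - ‖(φ ⟨0, by simp⟩ : X)‖) ^ 2 ≤ 1 - ‖(φ x : X)‖ ^ 2 := by
  obtain ⟨g, hg, e⟩ := hφ
  obtain ⟨ℓ, hℓ, hℓx⟩ := exists_dual_vector'' ℂ (φ x : X)
  have hlt : ∀ z ∈ unitBall X, ‖ℓ (g z)‖ < 1 := fun z hz => by
    have h1 : ‖ℓ (g z)‖ ≤ 1 * ‖g z‖ := ℓ.le_of_opNorm_le hℓ _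
    have h2 : ‖g z‖ < 1 := by
      rw [e ⟨z, hz⟩]
      exact mem_ball_zero_iff.1 (φ ⟨z, hz⟩).2
    linarith
  set α : ℝ := ‖(φ ⟨0, by simp⟩ : X)‖ with hα
  have h00 : (0 : X) ∈ unitBall X := by simp
  have hα1 : α < 1 := mem_ball_zero_iff.1 (φ ⟨0, h00⟩).2
  set a : ℂ := ℓ (g 0) with ha
  have haα : ‖a‖ ≤ α := by
    have h1 : ‖ℓ (g 0)‖ ≤ 1 * ‖g 0‖ := ℓ.le_of_opNorm_le hℓ _
    rw [e ⟨0, h00⟩] at h1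
    rw [ha, e ⟨0, h00⟩]
    linarith
  have ha1 : ‖a‖ < 1 := hlt 0 h00
  have key : ∀ w : ℂ, ‖1 - (starRingEnd ℂ) a * w‖ ^ 2 - ‖w - a‖ ^ 2
      = (1 - ‖a‖ ^ 2) * (1 - ‖w‖ ^ 2) := fun w => by
    simp only [← Complex.normSq_eq_norm_sq, Complex.normSq_apply]
    simp
    ring
  have hden : ∀ w : ℂ, ‖w‖ < 1 → 1 - α ≤ ‖1 - (starRingEnd ℂ) a * w‖ := fun w hw => by
    have h1 := norm_sub_norm_le (1 : ℂ) ((starRingEnd ℂ) a * w)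
    rw [norm_mul, RCLike.norm_conj, norm_one] at h1
    have : ‖a‖ * ‖w‖ ≤ α * 1 := mul_le_mul haα hw.le (norm_nonneg _) ((norm_nonneg _).trans haα)
    linarith
  have hne : ∀ w : ℂ, ‖w‖ < 1 → 1 - (starRingEnd ℂ) a * w ≠ 0 := fun w hw h => by
    have := hden w hw
    rw [h, norm_zero] at this
    linarith
  have hd : DifferentiableOn ℂ (fun z => ℓ (g z)) (unitBall X) :=
    ℓ.differentiable.comp_differentiableOn hg
  have hK : DifferentiableOn ℂ
      (fun z => (ℓ (g z) - a) / (1 - (starRingEnd ℂ) a * ℓ (g z))) (unitBall X) := by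
    simp only [div_eq_mul_inv]
    exact (hd.sub_const a).mul
      (((hd.const_mul _).const_sub _).inv fun z hz => hne _ (hlt z hz))
  have hS := Complex.norm_le_norm_of_mapsTo_ball (z := (x : X)) hK (fun z hz => by
    have hw := hlt z hz
    rw [mem_closedBall_zero_iff, norm_div]
    refine div_le_one_of_le₀ ?_ (norm_nonneg _)
    refine (sq_le_sq₀ (norm_nonneg _) (norm_nonneg _)).1 ?_
    have h1 := key (ℓ (g z))
    have h2 : 0 ≤ (1 - ‖a‖ ^ 2) * (1 - ‖ℓ (g z)‖ ^ 2) := by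
      apply mul_nonneg <;> nlinarith [norm_nonneg a, norm_nonneg (ℓ (g z))]
    linarith) (by simp [ha]) (by simpa using mem_ball_zero_iff.1 x.2)
  have hgx : ℓ (g x) = (‖(φ x : X)‖ : ℂ) := by rw [e x, hℓx]; rfl
  have hw := hlt x x.2
  have hpos : 0 < ‖1 - (starRingEnd ℂ) a * ℓ (g x)‖ := norm_pos_iff.2 (hne _ hw)
  rw [norm_div, div_le_iff₀ hpos] at hS
  have hn : ‖ℓ (g x)‖ = ‖(φ x : X)‖ := by rw [hgx]; simp
  have h1 := key (ℓ (g x))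
  rw [hn] at h1
  have h2 := hden _ hw
  set D := ‖1 - (starRingEnd ℂ) a * ℓ (g x)‖
  set N := ‖ℓ (g x) - a‖
  set t := ‖(φ x : X)‖
  have hx1 : ‖(x : X)‖ < 1 := mem_ball_zero_iff.1 x.2
  have hx0 : 0 ≤ ‖(x : X)‖ := norm_nonneg _
  have ht1 : t < 1 := mem_ball_zero_iff.1 (φ x).2
  have ht0 : 0 ≤ t := norm_nonneg _
  have h3 : N ^ 2 ≤ (‖(x : X)‖ * D) ^ 2 := pow_le_pow_left₀ (norm_nonneg _) hS 2
  have h4 : (1 - α) ^ 2 ≤ D ^ 2 := pow_le_pow_left₀ (by linarith) h2 2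
  have h5 : (1 - ‖(x : X)‖ ^ 2) * (1 - α) ^ 2 ≤ (1 - ‖(x : X)‖ ^ 2) * D ^ 2 :=
    mul_le_mul_of_nonneg_left h4 (by nlinarith)
  have h6 : (1 - ‖a‖ ^ 2) * (1 - t ^ 2) ≤ 1 * (1 - t ^ 2) :=
    mul_le_mul_of_nonneg_right (by nlinarith [sq_nonneg ‖a‖]) (by nlinarith)
  nlinarith

/-- A holomorphic self-map of the ball is of bounded type: it maps `B_X`-bounded sets to
`B_X`-bounded sets. -/
theorem IsUBounded.image_of_holomorphic {φ : unitBall X → unitBall X}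
    (hφ : IsHolomorphic (fun x => (φ x : X))) {A : Set (unitBall X)} (hA : IsUBounded A) :
    IsUBounded (φ '' A) := by
  obtain ⟨r, hr0, hr1, hr⟩ := (isUBounded_unitBall_iff A).1 hA
  have h00 : (0 : X) ∈ unitBall X := by simp
  have hα1 : ‖(φ ⟨0, h00⟩ : X)‖ < 1 := mem_ball_zero_iff.1 (φ ⟨0, h00⟩).2
  have hpos : 0 < (1 - r ^ 2) * (1 - ‖(φ ⟨0, h00⟩ : X)‖) ^ 2 :=
    mul_pos (by nlinarith) (pow_pos (by linarith) 2)
  refine (isUBounded_unitBall_iff _).2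
    ⟨Real.sqrt (1 - (1 - r ^ 2) * (1 - ‖(φ ⟨0, h00⟩ : X)‖) ^ 2), Real.sqrt_nonneg _, ?_, ?_⟩
  · rw [Real.sqrt_lt' one_pos]
    linarith
  · rintro _ ⟨x, hx, rfl⟩
    refine Real.le_sqrt_of_sq_le ?_
    have h1 := one_sub_sq_norm_ge_of_holomorphic φ hφ x
    have h2 : ‖(x : X)‖ ^ 2 ≤ r ^ 2 := pow_le_pow_left₀ (norm_nonneg _) (hr x hx) 2
    have h3 := mul_le_mul_of_nonneg_right (sub_le_sub_left h2 1)
      (sq_nonneg (1 - ‖(φ ⟨0, h00⟩ : X)‖))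
    linarith

/-- The composition operator `C_φ f = f ∘ φ` on the holomorphic functions of bounded type, for a
holomorphic self-map `φ` of the ball. -/
def compositionOperator (φ : unitBall X → unitBall X)
    (hφ : IsHolomorphic (fun x => (φ x : X))) :
    Hb (unitBall X) →L[ℂ] Hb (unitBall X) where
  toFun f := ⟨UniformOnFun.ofFun {A : Set (unitBall X) | IsUBounded A}
      (UniformOnFun.toFun {A : Set (unitBall X) | IsUBounded A} f.1 ∘ φ), by
    obtain ⟨g, hg, e⟩ := hφ
    obtain ⟨⟨F, hF, eF⟩, b⟩ := f.2
    refine ⟨⟨F ∘ g, hF.comp hg fun x hx => ?_, fun x => ?_⟩, fun A hA => ?_⟩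
    · rw [e ⟨x, hx⟩]
      exact (φ ⟨x, hx⟩).2
    · change F (g x) = UniformOnFun.toFun {A : Set (unitBall X) | IsUBounded A} f.1 (φ x)
      rw [e x, eF]
    · have := b _ (hA.image_of_holomorphic ⟨g, hg, e⟩)
      rwa [← image_comp] at this⟩
  map_add' _ _ := rfl
  map_smul' _ _ := rfl
  cont := by
    refine Continuous.subtype_mk ?_ _
    have hm : MapsTo (φ '' ·) {A : Set (unitBall X) | IsUBounded A}
        {A : Set (unitBall X) | IsUBounded A} := fun A hA =>
      IsUBounded.image_of_holomorphic hφ hA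
    exact (UniformOnFun.precomp_uniformContinuous (β := ℂ) hm).continuous.comp continuous_subtype_val

end Ball

/-! ### The polynomial topology -/

section Polynomials

variable (X : Type*) [NormedAddCommGroup X] [NormedSpace ℂ X]

/-- The continuous polynomials on `X`: finite sums of homogeneous polynomials
`x ↦ L_k (x, …, x)` with `L_k` a continuous `k`-linear form. -/
def continuousPolynomials : Set (X → ℂ) :=
  {P | ∃ (m : ℕ) (L : (k : ℕ) → ContinuousMultilinearMap ℂ (fun _ : Fin k => X) ℂ),
    ∀ x, P x = ∑ k ∈ Finset.range m, L k (fun _ => x)}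

/-- The topology `σ(X, 𝒫(X))`: the coarsest one making all continuous polynomials continuous. -/
@[reducible] def polynomialTopology : TopologicalSpace X :=
  ⨅ P ∈ continuousPolynomials X, TopologicalSpace.induced P inferInstance

variable {X} in
/-- `A` is relatively `σ(X, 𝒫(X))`-compact if its `σ(X, 𝒫(X))`-closure is compact. -/
def IsRelativelyPolynomialCompact (A : Set X) : Prop :=
  @IsCompact X (polynomialTopology X) (@closure X (polynomialTopology X) A)

end Polynomials

end

/-!
Both parts rest on the notion of stable orbits and on a Yosida-type argument for `T = C_φ`.

*Stable orbits.* If `φ` has stable orbits, then `T` is power bounded, since the supremum of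
`|F ∘ φ^n|` over a `B_X`-bounded set `A` is at most that of `|F|` over the set `L` containing the
orbits. Conversely, `φ` has stable orbits as soon as, for each `A`, one has
`|F(φ^n(x))| ≤ c_n` for `x ∈ A`, all `n` and all `F` in a neighbourhood of `0`, with arbitrary
constants `c_n`: applied to the powers `ℓ^m` of linear forms, the estimate loses its constants in
the limit `m → ∞` (`exists_isUBounded_of_bound_on_nhds_zero`). Power boundedness gives such bounds
directly. Mean ergodicity gives `T^n F = O(n)` for each `F`, and the Baire category theorem in the
Fréchet space `H_b(B_X)` makes this uniform on a neighbourhood of `0`.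

*Convergence of the Cesàro means.* Let `φ` have stable orbits. The means of `F` are uniformly
bounded on `B_X`-bounded sets, so they converge pointwise along an ultrafilter to some `H`, which is
again in `H_b(B_X)` because Cauchy estimates survive pointwise limits
(`differentiableAt_of_tendsto_ultrafilter`), and `T H = H`. Everything follows once `H` is
approximated, uniformly on each `B_X`-bounded set `A`, by functions `T G` with `G` a convex
combination of means: `F - T G` has Cesàro means tending to `0`, and the Cesàro means of `T G - H`
stay small. The approximation takes place in `C(K)`, where `K` is the
`σ(X, 𝒫(X))`-closure of `φ(A)`:

* elements of `H_b(B_X)` are continuous on `K`, since their Taylor series at `0` converges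
  uniformly on smaller balls (`exists_continuousPolynomial_near`);
* hence all ultrafilter limits of the means are continuous on the compact space `K`. This forces
  some subsequence to converge pointwise on `K` to `H`
  (`exists_convexCombination_near_ultrafilter_limit`);
* for a bounded pointwise convergent sequence with continuous limit, convex combinations converge
  uniformly, by the Hahn–Banach theorem, the Riesz–Markov–Kakutani theorem and dominated convergence
  (`exists_convexCombination_lt_of_tendsto_pointwise`).
-/

/-! ### Holomorphic functions on balls of a complex normed space -/

section HolomorphicOnBalls

open Metric

variable {X : Type*} [NormedAddCommGroup X] [NormedSpace ℂ X]

theorem norm_fderiv_le_of_norm_le_on_ball {g : X → ℂ} {x : X} {ρ C : ℝ} (hρ : 0 < ρ)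
    (hg : DifferentiableOn ℂ g (ball x ρ)) (hC : ∀ y ∈ ball x ρ, ‖g y‖ ≤ C) :
    ‖fderiv ℂ g x‖ ≤ 2 * C / ρ := by
  refine Complex.norm_fderiv_le_div_of_mapsTo_ball hg (fun y hy => ?_) hρ
  rw [mem_closedBall, dist_eq_norm]
  have h1 := hC y hy
  have h2 := hC x (mem_ball_self hρ)
  linarith [norm_sub_le (g y) (g x)]

/-- Quadratic bound for the first order Taylor remainder, with constants depending only on the sup
norm of the function on the ball. -/
theorem norm_sub_sub_fderiv_le_of_norm_le_on_ball {g : X → ℂ} {x w : X} {ρ C : ℝ} (hρ : 0 < ρ)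
    (hg : DifferentiableOn ℂ g (ball x ρ)) (hC : ∀ y ∈ ball x ρ, ‖g y‖ ≤ C) (hw : ‖w‖ < ρ) :
    ‖g (x + w) - g x - fderiv ℂ g x w‖ ≤ 4 * C * (‖w‖ / ρ) ^ 2 := by
  have hx := mem_ball_self hρ (x := x)
  have hdx : HasFDerivAt g (fderiv ℂ g x) x :=
    (hg.differentiableAt (isOpen_ball.mem_nhds hx)).hasFDerivAt
  have hnorm := norm_fderiv_le_of_norm_le_on_ball hρ hg hC
  have := Complex.dist_le_mul_div_pow_of_mapsTo_ball_of_isLittleO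
    (f := fun y => g y - g x - fderiv ℂ g x (y - x)) (c := x) (z := x + w) (R₁ := ρ) (R₂ := 4 * C)
    (n := 1) ?_ (fun y hy => ?_) ?_ (by simpa using hw)
  · simpa [dist_eq_norm] using this
  · exact (hg.sub_const _).sub
      ((fderiv ℂ g x).differentiable.comp (differentiable_id.sub_const x)).differentiableOn
  · have h1 := hC y hy
    have h2 := hC x hx
    have h3 : ‖fderiv ℂ g x (y - x)‖ ≤ 2 * C := by
      refine ((fderiv ℂ g x).le_of_opNorm_le hnorm _).trans ?_
      rw [mem_ball, dist_eq_norm] at hy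
      have hC0 : 0 ≤ C := (norm_nonneg _).trans h2
      rw [div_mul_eq_mul_div, div_le_iff₀ hρ]
      gcongr
    rw [mem_closedBall, dist_eq_norm]
    simp only [sub_self, map_zero, sub_zero]
    linarith [norm_sub_le (g y - g x) (fderiv ℂ g x (y - x)), norm_sub_le (g y) (g x)]
  · have := hdx.isLittleO
    simpa using this.norm_right

theorem exists_tendsto_of_norm_le {ι : Type*} (l : Ultrafilter ι) {u : ι → ℂ} {C : ℝ}
    (hu : ∀ i, ‖u i‖ ≤ C) : ∃ a, ‖a‖ ≤ C ∧ Tendsto u l (𝓝 a) := by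
  obtain ⟨a, ha, hl⟩ := (isCompact_closedBall (0 : ℂ) C).ultrafilter_le_nhds (l.map u)
    (le_principal_iff.2 (Filter.mem_map.2 (univ_mem' fun i => by simpa using hu i)))
  exact ⟨a, by simpa using ha, hl⟩

/-- A pointwise limit, along an ultrafilter, of uniformly bounded holomorphic functions on a ball
is differentiable at the centre. The derivatives converge weak-* along the ultrafilter, and the
quadratic remainder bound passes to the limit. -/
theorem differentiableAt_of_tendsto_ultrafilter {ι : Type*} (l : Ultrafilter ι) {G : ι → X → ℂ}
    {g : X → ℂ} {x : X} {ρ C : ℝ} (hρ : 0 < ρ) (hG : ∀ i, DifferentiableOn ℂ (G i) (ball x ρ))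
    (hC : ∀ i, ∀ y ∈ ball x ρ, ‖G i y‖ ≤ C)
    (hlim : ∀ y ∈ ball x ρ, Tendsto (fun i => G i y) l (𝓝 (g y))) : DifferentiableAt ℂ g x := by
  have hn := fun i => norm_fderiv_le_of_norm_le_on_ball hρ (hG i) (hC i)
  have hA : ∀ v, ∃ a, Tendsto (fun i => fderiv ℂ (G i) x v) l (𝓝 a) := fun v => by
    obtain ⟨a, -, ha⟩ := exists_tendsto_of_norm_le l (u := fun i => fderiv ℂ (G i) x v)
      (C := 2 * C / ρ * ‖v‖) fun i => (fderiv ℂ (G i) x).le_of_opNorm_le (hn i) v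
    exact ⟨a, ha⟩
  choose a ha using hA
  let A : X →L[ℂ] ℂ := ContinuousLinearMap.ofTendstoOfBoundedRange a
    (fun i => fderiv ℂ (G i) x) (l := (l : Filter ι)) (tendsto_pi_nhds.2 ha)
    (isBounded_iff_forall_norm_le.2 ⟨2 * C / ρ, by rintro _ ⟨i, rfl⟩; exact hn i⟩)
  have hx := mem_ball_self hρ (x := x)
  have hrem : ∀ w : X, ‖w‖ < ρ → ‖g (x + w) - g x - A w‖ ≤ 4 * C * (‖w‖ / ρ) ^ 2 := fun w hw =>
    le_of_tendsto (((hlim (x + w) (by simpa using hw)).sub (hlim x hx)).sub (ha w)).norm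
      (Eventually.of_forall fun i =>
        norm_sub_sub_fderiv_le_of_norm_le_on_ball hρ (hG i) (hC i) hw)
  refine HasFDerivAt.differentiableAt (f' := A) ?_
  rw [hasFDerivAt_iff_isLittleO_nhds_zero]
  have hO : (fun w => g (x + w) - g x - A w) =O[𝓝 0] fun w => ‖w‖ ^ 2 := by
    refine Asymptotics.IsBigO.of_bound (4 * C / ρ ^ 2) ?_
    filter_upwards [ball_mem_nhds (0 : X) hρ] with w hw
    refine (hrem w (by simpa using hw)).trans_eq ?_
    rw [norm_pow, norm_norm]
    ring
  exact hO.trans_isLittleO (Asymptotics.isLittleO_norm_pow_id one_lt_two)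

/-- Directional derivatives of holomorphic functions are holomorphic: they are pointwise limits of
locally bounded difference quotients. -/
theorem differentiableOn_fderiv_apply {f : X → ℂ} {U : Set X} (hU : IsOpen U)
    (hf : DifferentiableOn ℂ f U) (v : X) : DifferentiableOn ℂ (fun x => fderiv ℂ f x v) U := by
  intro x hx
  refine DifferentiableAt.differentiableWithinAt ?_
  obtain ⟨C, hC⟩ : ∃ C, ∀ᶠ y in 𝓝 x, ‖f y‖ ≤ C := by
    have h1 := (hf.differentiableAt (hU.mem_nhds hx)).continuousAt.norm
    exact ⟨‖f x‖ + 1, (h1.eventually_lt_const (lt_add_one _)).mono fun _ h => h.le⟩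
  obtain ⟨ε, hε, hball⟩ := Metric.mem_nhds_iff.1 (inter_mem (hU.mem_nhds hx) hC)
  set ρ := ε / 3 with hρ'
  have hρ : 0 < ρ := by positivity
  have hdist : ∀ y ∈ ball x ρ, ∀ w : X, ‖w‖ < 2 * ρ → y + w ∈ ball x ε := fun y hy w hw => by
    rw [mem_ball, dist_eq_norm] at *
    calc ‖y + w - x‖ = ‖(y - x) + w‖ := by abel_nf
      _ ≤ ‖y - x‖ + ‖w‖ := norm_add_le _ _
      _ < ε := by rw [hρ'] at *; linarith
  have hfd : ∀ y ∈ ball x ε, DifferentiableAt ℂ f y := fun y hy =>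
    hf.differentiableAt (hU.mem_nhds (hball hy).1)
  have hsub : ∀ y ∈ ball x ρ, ball y ρ ⊆ ball x ε := fun y hy z hz => by
    have := hdist y hy (z - y) (by rw [mem_ball, dist_eq_norm] at hz; linarith)
    simpa using this
  have hquot : ∀ y ∈ ball x ρ, ∀ w : X, ‖w‖ < ρ → ‖f (y + w) - f y‖ ≤ 6 * C / ρ * ‖w‖ := by
    intro y hy w hw
    have hd : DifferentiableOn ℂ f (ball y ρ) := fun z hz =>
      (hfd z (hsub y hy hz)).differentiableWithinAt
    have hb : ∀ z ∈ ball y ρ, ‖f z‖ ≤ C := fun z hz => (hball (hsub y hy hz)).2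
    have hC0 : 0 ≤ C := (norm_nonneg _).trans (hb y (mem_ball_self hρ))
    have h1 := norm_sub_sub_fderiv_le_of_norm_le_on_ball hρ hd hb hw
    have h2 := (fderiv ℂ f y).le_of_opNorm_le (norm_fderiv_le_of_norm_le_on_ball hρ hd hb) w
    have h3 : ‖f (y + w) - f y‖ ≤ ‖f (y + w) - f y - fderiv ℂ f y w‖ + ‖fderiv ℂ f y w‖ := by
      simpa using norm_add_le (f (y + w) - f y - fderiv ℂ f y w) (fderiv ℂ f y w)
    have h4 : (‖w‖ / ρ) ^ 2 ≤ ‖w‖ / ρ := by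
      have : ‖w‖ / ρ ≤ 1 := (div_le_one hρ).2 hw.le
      have h0 : 0 ≤ ‖w‖ / ρ := by positivity
      nlinarith
    calc _ ≤ 4 * C * (‖w‖ / ρ) + 2 * C / ρ * ‖w‖ := h3.trans (add_le_add (h1.trans (by gcongr)) h2)
      _ = _ := by ring
  -- Difference quotients with steps `t n → 0` small enough to stay inside the ball.
  let t : ℕ → ℝ := fun n => ρ / ((‖v‖ + 1) * (n + 1))
  have ht0 : ∀ n, 0 < t n := fun n => by positivity
  have htv : ∀ n, ‖((t n : ℂ)) • v‖ < ρ := fun n => by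
    rw [norm_smul, Complex.norm_real, Real.norm_of_nonneg (ht0 n).le, div_mul_eq_mul_div,
      div_lt_iff₀ (by positivity)]
    have : ‖v‖ < (‖v‖ + 1) * (n + 1) := by
      have : (0 : ℝ) ≤ n := n.cast_nonneg
      nlinarith [norm_nonneg v]
    gcongr
  have htlim : Tendsto (fun n => (t n : ℂ)) atTop (𝓝[≠] 0) := by
    refine tendsto_nhdsWithin_iff.2 ⟨?_, Eventually.of_forall fun n => ?_⟩
    · have : Tendsto t atTop (𝓝 0) := by
        have := (tendsto_one_div_add_atTop_nhds_zero_nat (𝕜 := ℝ)).const_mul (ρ / (‖v‖ + 1))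
        rw [mul_zero] at this
        refine this.congr fun n => ?_
        simp only [t]
        field_simp
      exact_mod_cast (Complex.continuous_ofReal.tendsto 0).comp this
    · simpa using (ht0 n).ne'
  refine differentiableAt_of_tendsto_ultrafilter (hyperfilter ℕ)
    (G := fun n y => (t n : ℂ)⁻¹ • (f (y + (t n : ℂ) • v) - f y)) (ρ := ρ)
    (C := 6 * C / ρ * ‖v‖) hρ (fun n y hy => ?_) (fun n y hy => ?_) (fun y hy => ?_)
  · refine DifferentiableAt.differentiableWithinAt (DifferentiableAt.fun_const_smul ?_ _)
    refine DifferentiableAt.sub ?_ (hfd y (hsub y hy (mem_ball_self hρ)))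
    exact (hfd _ (hdist y hy _ ((htv n).trans (by linarith)))).comp y (differentiableAt_id.add_const _)
  · have := hquot y hy _ (htv n)
    rw [norm_smul, Complex.norm_real, Real.norm_of_nonneg (ht0 n).le] at this
    rw [norm_smul, norm_inv, Complex.norm_real, Real.norm_of_nonneg (ht0 n).le,
      inv_mul_le_iff₀ (ht0 n)]
    linarith
  · have h1 : HasLineDerivAt ℂ f (fderiv ℂ f y v) y v :=
      (hfd y (hsub y hy (mem_ball_self hρ))).hasFDerivAt.hasLineDerivAt v
    have h2 := h1.tendsto_slope_zero.comp htlim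
    exact h2.mono_left Nat.hyperfilter_le_atTop

end HolomorphicOnBalls

/-! ### Taylor polynomials of holomorphic functions -/

section Taylor

open Metric

variable {X : Type*} [NormedAddCommGroup X] [NormedSpace ℂ X]

variable (X) in
/-- The functions on `X` that are holomorphic on the open unit ball; their values off the ball are
arbitrary. -/
def holomorphicFunctions : Submodule ℂ (X → ℂ) where
  carrier := {f | DifferentiableOn ℂ f (ball 0 1)}
  zero_mem' := differentiableOn_const _
  add_mem' hf hg := DifferentiableOn.add hf hg
  smul_mem' c _ hf := DifferentiableOn.const_smul hf c

theorem differentiableAt_of_holomorphicFunctions (f : holomorphicFunctions X) {x : X}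
    (hx : x ∈ ball (0 : X) 1) : DifferentiableAt ℂ f.1 x :=
  DifferentiableOn.differentiableAt f.2 (isOpen_ball.mem_nhds hx)

open Classical in
/-- The directional derivative `f ↦ (x ↦ Df(x) v)`, linear in the direction `v` and as an operator
on holomorphic functions. It is set to `0` off the ball, where `f` need not be differentiable, since
additivity in `f` would fail there otherwise. -/
noncomputable def directionalDerivative : X →ₗ[ℂ] Module.End ℂ (holomorphicFunctions X) where
  toFun v :=
    { toFun := fun f => ⟨fun x => if x ∈ ball (0 : X) 1 then fderiv ℂ f.1 x v else 0,
        (differentiableOn_fderiv_apply isOpen_ball f.2 v).congr fun x hx => if_pos hx⟩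
      map_add' := fun f g => by
        ext x
        by_cases hx : x ∈ ball (0 : X) 1
        · simp only [hx, if_true, Submodule.coe_add, Pi.add_apply]
          rw [fderiv_add (differentiableAt_of_holomorphicFunctions f hx)
            (differentiableAt_of_holomorphicFunctions g hx)]
          rfl
        · simp [hx, -mem_ball]
      map_smul' := fun c f => by
        ext x
        by_cases hx : x ∈ ball (0 : X) 1
        · simp only [hx, if_true, Submodule.coe_smul, Pi.smul_apply]
          rw [fderiv_const_smul (differentiableAt_of_holomorphicFunctions f hx)]
          rfl
        · simp [hx, -mem_ball] }
  map_add' v w := by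
    ext f x
    by_cases hx : x ∈ ball (0 : X) 1 <;> simp [hx, -mem_ball]
  map_smul' c v := by
    ext f x
    by_cases hx : x ∈ ball (0 : X) 1 <;> simp [hx, -mem_ball]

theorem directionalDerivative_apply (v : X) (f : holomorphicFunctions X) {x : X}
    (hx : x ∈ ball (0 : X) 1) : (directionalDerivative v f).1 x = fderiv ℂ f.1 x v :=
  if_pos hx

/-- Cauchy estimates for iterated directional derivatives, on balls shrinking with the order. -/
theorem exists_norm_prod_directionalDerivative_le (f : holomorphicFunctions X) {r M : ℝ}
    (hr : 0 < r) (hr1 : r ≤ 1) (hM : ∀ x ∈ ball (0 : X) r, ‖f.1 x‖ ≤ M) (k : ℕ) :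
    ∃ C : ℝ, ∀ l : List X, l.length = k → ∀ x ∈ ball (0 : X) (r / 2 ^ k),
      ‖((l.map directionalDerivative).prod f).1 x‖ ≤ C * (l.map norm).prod := by
  induction k with
  | zero =>
    refine ⟨M, fun l hl x hx => ?_⟩
    obtain rfl := List.length_eq_zero_iff.1 hl
    simpa using hM x (by simpa using hx)
  | succ k ih =>
    obtain ⟨C, hC⟩ := ih
    refine ⟨2 * C / (r / 2 ^ (k + 1)), fun l hl x hx => ?_⟩
    obtain ⟨v, l, rfl⟩ := List.exists_of_length_succ l hl
    have hl' : l.length = k := by simpa using hl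
    have hs : 0 < r / 2 ^ (k + 1) := by positivity
    have hs2 : r / 2 ^ (k + 1) + r / 2 ^ (k + 1) = r / 2 ^ k := by
      rw [pow_succ]; field_simp; ring
    have hsub : ball x (r / 2 ^ (k + 1)) ⊆ ball 0 (r / 2 ^ k) := by
      refine ball_subset_ball' ?_
      rw [← hs2]
      exact add_le_add_right (mem_ball.1 hx).le _
    have hle : r / 2 ^ k ≤ 1 :=
      (div_le_self hr.le (one_le_pow₀ one_le_two)).trans hr1
    have hsub1 : ball x (r / 2 ^ (k + 1)) ⊆ ball 0 1 := hsub.trans (ball_subset_ball hle)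
    set g := (l.map directionalDerivative).prod f with hg
    have h1 := norm_fderiv_le_of_norm_le_on_ball hs (DifferentiableOn.mono g.2 hsub1)
      fun y hy => hC l hl' y (hsub hy)
    rw [List.map_cons, List.prod_cons, Module.End.mul_apply,
      directionalDerivative_apply _ _ (hsub1 (mem_ball_self hs)), List.map_cons, List.prod_cons]
    refine ((fderiv ℂ g.1 x).le_of_opNorm_le h1 v).trans_eq ?_
    ring

/-- The iterated directional derivatives at `0` of a holomorphic function, as a continuous
multilinear form of the directions. -/
theorem exists_continuousMultilinearMap_eq_prod_directionalDerivative
    (f : holomorphicFunctions X) (k : ℕ) :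
    ∃ L : ContinuousMultilinearMap ℂ (fun _ : Fin k => X) ℂ,
      ∀ x, L (fun _ => x) = ((directionalDerivative x ^ k) f).1 0 := by
  let evalZero : Module.End ℂ (holomorphicFunctions X) →ₗ[ℂ] ℂ :=
    { toFun := fun T => (T f).1 0
      map_add' := fun _ _ => rfl
      map_smul' := fun _ _ => rfl }
  let L : MultilinearMap ℂ (fun _ : Fin k => X) ℂ := evalZero.compMultilinearMap
    ((MultilinearMap.mkPiAlgebraFin ℂ k (Module.End ℂ (holomorphicFunctions X))).compLinearMap
      fun _ => directionalDerivative)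
  have hL : ∀ v, L v = (((List.ofFn v).map directionalDerivative).prod f).1 0 := fun v => by
    simp [L, evalZero, List.map_ofFn, Function.comp_def]
  obtain ⟨r, hr, hr1, M, hM⟩ : ∃ r : ℝ, 0 < r ∧ r ≤ 1 ∧ ∃ M, ∀ x ∈ ball (0 : X) r, ‖f.1 x‖ ≤ M := by
    have hc := (differentiableAt_of_holomorphicFunctions f (x := 0) (by simp)).continuousAt.norm
    obtain ⟨ε, hε, h⟩ := Metric.eventually_nhds_iff_ball.1
      (hc.eventually_lt_const (lt_add_one _))
    exact ⟨min ε 1, by positivity, min_le_right _ _, _, fun x hx =>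
      (h x (ball_subset_ball (min_le_left _ _) hx)).le⟩
  obtain ⟨C, hC⟩ := exists_norm_prod_directionalDerivative_le f hr hr1 hM k
  refine ⟨L.mkContinuous C fun v => ?_, fun x => ?_⟩
  · rw [hL]
    refine (hC _ (List.length_ofFn) 0 (mem_ball_self (by positivity))).trans_eq ?_
    rw [List.map_ofFn, List.prod_ofFn]
    rfl
  · rw [MultilinearMap.coe_mkContinuous, hL]
    simp [List.ofFn_const]

theorem iteratedDeriv_comp_smul_eq_directionalDerivative_pow (f : holomorphicFunctions X) (x : X)
    (k : ℕ) {z : ℂ} (hz : z • x ∈ ball (0 : X) 1) :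
    iteratedDeriv k (fun z : ℂ => f.1 (z • x)) z = ((directionalDerivative x ^ k) f).1 (z • x) := by
  induction k generalizing z with
  | zero => simp
  | succ k ih =>
    have hev : ∀ᶠ w : ℂ in 𝓝 z, w • x ∈ ball (0 : X) 1 :=
      (continuous_id.smul continuous_const).continuousAt.eventually_mem (isOpen_ball.mem_nhds hz)
    have heq : iteratedDeriv k (fun z : ℂ => f.1 (z • x)) =ᶠ[𝓝 z]
        fun w => ((directionalDerivative x ^ k) f).1 (w • x) := hev.mono fun w hw => ih hw
    rw [iteratedDeriv_succ, heq.deriv_eq, pow_succ', Module.End.mul_apply,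
      directionalDerivative_apply _ _ hz]
    have h1 :=
      (differentiableAt_of_holomorphicFunctions ((directionalDerivative x ^ k) f) hz).hasFDerivAt
    have h2 : HasDerivAt (fun w : ℂ => w • x) x z := by
      simpa using (hasDerivAt_id z).smul_const x
    exact (h1.comp_hasDerivAt z h2).deriv

/-- A holomorphic function that is bounded on the ball of radius `s < 1` is, on each smaller ball, a
uniform limit of continuous polynomials: the partial sums of its Taylor series at `0`, whose
terms are controlled on complex lines by the Cauchy estimates. -/
theorem exists_continuousPolynomial_near {f : X → ℂ} (hf : DifferentiableOn ℂ f (ball 0 1))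
    {r s M : ℝ} (hr : 0 < r) (hrs : r < s) (hs1 : s < 1) (hM : ∀ x, ‖x‖ ≤ s → ‖f x‖ ≤ M)
    {ε : ℝ} (hε : 0 < ε) :
    ∃ P ∈ continuousPolynomials X, ∀ x, ‖x‖ ≤ r → ‖f x - P x‖ < ε := by
  let F : holomorphicFunctions X := ⟨f, hf⟩
  choose L hL using exists_continuousMultilinearMap_eq_prod_directionalDerivative F
  have hs0 : 0 < s := hr.trans hrs
  have hM0 : 0 ≤ M := (norm_nonneg _).trans (hM 0 (by simpa using hs0.le))
  have hq : r / s < 1 := (div_lt_one hs0).2 hrs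
  have hq0 : 0 ≤ r / s := by positivity
  obtain ⟨m, hm⟩ : ∃ m : ℕ, M * (r / s) ^ m / (1 - r / s) < ε := by
    have h := ((tendsto_pow_atTop_nhds_zero_of_lt_one hq0 hq).const_mul M).div_const (1 - r / s)
    rw [mul_zero, zero_div] at h
    exact (h.eventually_lt_const hε).exists
  refine ⟨fun x => ∑ k ∈ Finset.range m, ((k.factorial : ℂ)⁻¹ • L k) fun _ => x, ⟨m, _, fun x => rfl⟩,
    fun x hx => ?_⟩
  have hR : 1 < s / r := (one_lt_div hr).2 hrs
  have hRx : ∀ z : ℂ, ‖z‖ ≤ s / r → ‖z • x‖ ≤ s := fun z hz => by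
    rw [norm_smul]
    calc ‖z‖ * ‖x‖ ≤ s / r * r := by gcongr
      _ = s := by field_simp
  have hd : DifferentiableOn ℂ (fun z : ℂ => f (z • x)) (closedBall 0 (s / r)) := fun z hz =>
    ((differentiableAt_of_holomorphicFunctions F (x := z • x) (by
      simpa using (hRx z (by simpa using hz)).trans_lt hs1)).comp z
        (differentiableAt_id.smul_const x)).differentiableWithinAt
  have hcoef : ∀ k, L k (fun _ => x) = iteratedDeriv k (fun z : ℂ => f (z • x)) 0 := fun k => by
    rw [hL, iteratedDeriv_comp_smul_eq_directionalDerivative_pow F x k (by simp), zero_smul]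
  have hsum := Complex.hasSum_taylorSeries_on_ball (hd.mono ball_subset_closedBall) (z := 1)
    (by simpa using hR)
  simp only [sub_zero, one_pow, one_smul, ← hcoef] at hsum
  have := norm_sub_le_of_geometric_bound_of_hasSum (C := M) hq (fun k => ?_) hsum m
  · rw [norm_sub_rev]
    exact this.trans_lt hm
  · have hcauchy := Complex.norm_iteratedDeriv_le_of_forall_mem_sphere_norm_le k (one_pos.trans hR)
      (hd.diffContOnCl_ball Subset.rfl)
      (fun z hz => hM _ (hRx z (by simpa using (mem_sphere.1 hz).le)))
    rw [norm_smul, norm_inv, Complex.norm_natCast, hcoef, inv_mul_le_iff₀ (by positivity)]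
    refine hcauchy.trans_eq ?_
    rw [← inv_div s r, inv_pow]
    ring

end Taylor

/-! ### Pointwise limits and convex combinations on compact spaces -/

section ConvexCombinations

open MeasureTheory
open scoped CompactlySupported

/-- Two continuous functions on a compact space that are constant on the fibres of a continuous map
`Φ` agree as soon as they agree on a set whose image under `Φ` is dense in the range. -/
theorem eq_of_eqOn_of_dense_image {K Y : Type*} [TopologicalSpace K]
    [CompactSpace K] [TopologicalSpace Y] [T2Space Y] {Φ : K → Y}
    (hΦ : Continuous Φ) {D : Set K} (hD : range Φ ⊆ closure (Φ '' D)) {g h : K → ℂ}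
    (hg : Continuous g) (hh : Continuous h) (hgΦ : ∀ x y, Φ x = Φ y → g x = g y)
    (hhΦ : ∀ x y, Φ x = Φ y → h x = h y) (hgh : ∀ x ∈ D, g x = h x) : g = h := by
  funext x
  have hcl : IsClosed (Φ '' {y | g y = h y}) :=
    ((isClosed_eq hg hh).isCompact.image hΦ).isClosed
  obtain ⟨y, hy, hyx⟩ := closure_minimal (image_mono hgh) hcl (hD (mem_range_self x))
  rw [← hgΦ _ _ hyx, ← hhΦ _ _ hyx]
  exact hy

variable {K : Type*} [TopologicalSpace K] [CompactSpace K] [T2Space K]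

/-- A positive functional on `C(K)` sends bounded sequences tending pointwise to zero to null
sequences: represent it by a measure and use dominated convergence. -/
theorem tendsto_positiveFunctional_of_tendsto_pointwise (Λ : C(K, ℝ) →L[ℝ] ℝ)
    (hΛ : ∀ g : C(K, ℝ), 0 ≤ g → 0 ≤ Λ g) {u : ℕ → C(K, ℝ)} {M : ℝ}
    (hM : ∀ n x, ‖u n x‖ ≤ M) (hu : ∀ x, Tendsto (fun n => u n x) atTop (𝓝 0)) :
    Tendsto (fun n => Λ (u n)) atTop (𝓝 0) := by
  borelize K
  let Λ₀ : C_c(K, ℝ) →ₗ[ℝ] ℝ :=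
    { toFun := fun g => Λ g.toContinuousMap
      map_add' := fun _ _ => map_add Λ _ _
      map_smul' := fun _ _ => map_smul Λ _ _ }
  let Λ' : C_c(K, ℝ) →ₚ[ℝ] ℝ := PositiveLinearMap.mk₀ Λ₀ fun g hg => hΛ _ hg
  have hint : ∀ g : C(K, ℝ), Λ g = ∫ x, g x ∂(RealRMK.rieszMeasure Λ') := fun g =>
    (RealRMK.integral_rieszMeasure Λ'
      (CompactlySupportedContinuousMap.continuousMapEquiv g)).symm
  simp only [hint]
  rw [← integral_zero K ℝ (μ := RealRMK.rieszMeasure Λ')]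
  exact tendsto_integral_of_dominated_convergence (fun _ => M)
    (fun n => (u n).continuous.aestronglyMeasurable) (integrable_const M)
    (fun n => Eventually.of_forall (hM n)) (Eventually.of_forall hu)

/-- If a bounded sequence of nonnegative continuous functions on a compact space tends to `0`
pointwise, then some convex combinations of its terms are uniformly small. Otherwise the
functions below `ε` could be separated from the convex hull by a functional, necessarily positive,
that is bounded away from `0` on the sequence. -/
theorem exists_convexCombination_lt_of_tendsto_pointwise {u : ℕ → C(K, ℝ)} {M : ℝ}
    (h0 : ∀ n x, 0 ≤ u n x) (hM : ∀ n x, u n x ≤ M)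
    (hu : ∀ x, Tendsto (fun n => u n x) atTop (𝓝 0)) {ε : ℝ} (hε : 0 < ε) :
    ∃ (s : Finset ℕ) (w : ℕ → ℝ), (∀ k ∈ s, 0 ≤ w k) ∧ ∑ k ∈ s, w k = 1 ∧
      ∀ x, ∑ k ∈ s, w k * u k x < ε := by
  by_contra! hcon
  let S : Set C(K, ℝ) := {g | ∀ x, g x < ε}
  have hSo : IsOpen S := by
    have := ContinuousMap.isOpen_setOfPred_mapsTo (X := K) (Y := ℝ) isCompact_univ (isOpen_Iio (a := ε))
    simpa [S, MapsTo] using this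
  have hSc : Convex ℝ S := fun g hg g' hg' a b ha hb hab x => by
    simpa using convex_Iio (𝕜 := ℝ) ε (hg x) (hg' x) ha hb hab
  have hdisj : Disjoint S (convexHull ℝ (range u)) := by
    rw [Set.disjoint_left]
    intro g hg hgc
    rw [convexHull_range_eq_exists_affineCombination] at hgc
    obtain ⟨s, w, hw0, hw1, rfl⟩ := hgc
    obtain ⟨x, hx⟩ := hcon s w hw0 hw1
    rw [s.affineCombination_eq_linear_combination _ _ hw1] at hg
    have := hg x
    simp only [ContinuousMap.sum_apply, ContinuousMap.smul_apply, smul_eq_mul] at this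
    linarith
  obtain ⟨Λ, c, hΛS, hΛu⟩ := geometric_hahn_banach_open hSc hSo (convex_convexHull ℝ _) hdisj
  have hc : 0 < c := by simpa using hΛS 0 fun x => by simpa using hε
  have hpos : ∀ g : C(K, ℝ), 0 ≤ g → 0 ≤ Λ g := by
    intro g hg
    by_contra! hneg
    have := hΛS ((c / Λ g) • g) fun x => by
      have h1 : c / Λ g ≤ 0 := (div_neg_of_pos_of_neg hc hneg).le
      have h2 : 0 ≤ g x := hg x
      simpa using (mul_nonpos_of_nonpos_of_nonneg h1 h2).trans_lt hε
    rw [map_smul, smul_eq_mul, div_mul_cancel₀ _ hneg.ne] at this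
    exact lt_irrefl _ this
  have hlim := tendsto_positiveFunctional_of_tendsto_pointwise Λ hpos (M := M)
    (fun n x => by rw [Real.norm_of_nonneg (h0 n x)]; exact hM n x) hu
  exact hc.not_ge (ge_of_tendsto hlim (Eventually.of_forall fun n =>
    hΛu _ (subset_convexHull ℝ _ (mem_range_self n))))

/-- If all pointwise limits along ultrafilters of a bounded sequence in `C(K)` are continuous, each
of these limits is uniformly approximated by convex combinations of the sequence.

A countable set `D` whose image is dense in the image of `K` under all the `f n` yields a subsequence
converging to the limit on `D`. Every pointwise cluster point of the subsequence is continuous and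
agrees with the limit on `D`, hence everywhere, so the subsequence converges pointwise. -/
theorem exists_convexCombination_near_ultrafilter_limit {f : ℕ → K → ℂ} {M : ℝ}
    (hf : ∀ n, Continuous (f n)) (hM : ∀ n x, ‖f n x‖ ≤ M)
    (hcont : ∀ (V : Ultrafilter ℕ) (g : K → ℂ),
      (∀ x, Tendsto (fun n => f n x) V (𝓝 (g x))) → Continuous g)
    (V : Ultrafilter ℕ) {h : K → ℂ} (hlim : ∀ x, Tendsto (fun n => f n x) V (𝓝 (h x)))
    {ε : ℝ} (hε : 0 < ε) :
    ∃ (s : Finset ℕ) (w : ℕ → ℝ) (n : ℕ → ℕ), (∀ k ∈ s, 0 ≤ w k) ∧ ∑ k ∈ s, w k = 1 ∧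
      ∀ x, ‖∑ k ∈ s, (w k : ℂ) * f (n k) x - h x‖ < ε := by
  rcases isEmpty_or_nonempty K with hK | hK
  · exact ⟨{0}, 1, id, by simp, by simp, fun x => hK.elim x⟩
  have hh := hcont V h hlim
  let Φ : K → ℕ → ℂ := fun x n => f n x
  have hΦ : Continuous Φ := continuous_pi hf
  have hfib : ∀ (W : Ultrafilter ℕ) (g : K → ℂ), (∀ x, Tendsto (fun n => f n x) W (𝓝 (g x))) →
      ∀ x y, Φ x = Φ y → g x = g y := fun W g hg x y hxy => by
    refine tendsto_nhds_unique (hg x) ((hg y).congr fun n => ?_)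
    exact (congrFun hxy n).symm
  obtain ⟨d, hd⟩ : ∃ d : ℕ → K, range Φ ⊆ closure (Φ '' range d) := by
    obtain ⟨e, he⟩ := TopologicalSpace.exists_dense_seq (range Φ)
    choose d hd using fun i => (e i).2
    refine ⟨d, fun y hy => ?_⟩
    have h1 := image_closure_subset_closure_image (f := Subtype.val) (s := range e)
      continuous_subtype_val (mem_image_of_mem _ (he ⟨y, hy⟩))
    refine closure_mono ?_ h1
    rintro _ ⟨_, ⟨i, rfl⟩, rfl⟩
    exact ⟨d i, mem_range_self i, hd i⟩
  have hsub : ∀ k : ℕ, ∃ n, ∀ i ∈ Finset.range (k + 1), dist (f n (d i)) (h (d i)) < 1 / (k + 1) :=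
    fun k => ((Finset.eventually_all _).2 fun i _ =>
      Metric.tendsto_nhds.1 (hlim (d i)) _ Nat.one_div_pos_of_nat).exists
  choose n hn using hsub
  have hnd : ∀ i, Tendsto (fun k => f (n k) (d i)) atTop (𝓝 (h (d i))) := fun i => by
    rw [tendsto_iff_dist_tendsto_zero]
    refine squeeze_zero' (Eventually.of_forall fun _ => dist_nonneg) ?_
      tendsto_one_div_add_atTop_nhds_zero_nat
    filter_upwards [eventually_ge_atTop i] with k hk
    exact (hn k i (Finset.mem_range.2 (by omega))).le
  have hnx : ∀ x, Tendsto (fun k => f (n k) x) atTop (𝓝 (h x)) := by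
    intro x
    rw [tendsto_iff_ultrafilter]
    intro W hW
    choose g _ hg using fun y => exists_tendsto_of_norm_le (W.map n) (u := fun n => f n y)
      fun n => hM n y
    have hgh : g = h := by
      refine eq_of_eqOn_of_dense_image hΦ hd (hcont _ g hg) hh (hfib _ g hg) (hfib V h hlim) ?_
      rintro _ ⟨i, rfl⟩
      exact tendsto_nhds_unique (hg (d i)) (Filter.tendsto_map'_iff.2 ((hnd i).mono_left hW))
    rw [← hgh]
    exact Filter.tendsto_map'_iff.1 (hg x)
  let u : ℕ → C(K, ℝ) := fun k => ⟨fun x => ‖f (n k) x - h x‖, ((hf _).sub hh).norm⟩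
  have hhM : ∀ x, ‖h x‖ ≤ M := fun x =>
    le_of_tendsto (hlim x).norm (Eventually.of_forall fun n => hM n x)
  obtain ⟨s, w, hw0, hw1, hw⟩ := exists_convexCombination_lt_of_tendsto_pointwise (u := u)
    (M := M + M) (fun k x => norm_nonneg (f (n k) x - h x))
    (fun k x => (norm_sub_le _ _).trans (add_le_add (hM _ x) (hhM x)))
    (fun x => by simpa [u] using ((hnx x).sub_const (h x)).norm) hε
  refine ⟨s, w, n, hw0, hw1, fun x => lt_of_le_of_lt ?_ (hw x)⟩
  have heq : ∑ k ∈ s, (w k : ℂ) * f (n k) x - h x = ∑ k ∈ s, (w k : ℂ) * (f (n k) x - h x) := by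
    simp only [mul_sub, Finset.sum_sub_distrib, ← Finset.sum_mul]
    rw [← Complex.ofReal_sum, hw1, Complex.ofReal_one, one_mul]
  rw [heq]
  refine (norm_sum_le _ _).trans (Finset.sum_le_sum fun k hk => ?_)
  rw [norm_mul, Complex.norm_real, Real.norm_of_nonneg (hw0 k hk)]
  rfl

end ConvexCombinations

/-! ### The polynomial topology on bounded sets -/

section PolynomialTopology

open Metric

/-- The space `X` with the topology `σ(X, 𝒫(X))`. -/
def PolynomialSpace (X : Type*) : Type _ := X

variable {X : Type*} [NormedAddCommGroup X] [NormedSpace ℂ X]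

noncomputable instance : TopologicalSpace (PolynomialSpace X) := polynomialTopology X

theorem continuous_of_mem_continuousPolynomials {P : X → ℂ} (hP : P ∈ continuousPolynomials X) :
    Continuous (X := PolynomialSpace X) P :=
  continuous_iInf_dom (i := P) (continuous_iInf_dom (i := hP) continuous_induced_dom)

theorem dual_mem_continuousPolynomials (ℓ : X →L[ℂ] ℂ) : (ℓ : X → ℂ) ∈ continuousPolynomials X := by
  refine ⟨2, fun k => match k with
    | 1 => ContinuousMultilinearMap.ofSubsingleton ℂ X ℂ (0 : Fin 1) ℓ
    | _ => 0, fun x => ?_⟩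
  simp [Finset.sum_range_succ]

theorem continuous_dual_polynomialSpace (ℓ : X →L[ℂ] ℂ) : Continuous (X := PolynomialSpace X) ℓ :=
  continuous_of_mem_continuousPolynomials (dual_mem_continuousPolynomials ℓ)

instance : T2Space (PolynomialSpace X) := by
  refine ⟨fun x y hxy => ?_⟩
  obtain ⟨ℓ, hℓ⟩ := SeparatingDual.exists_separating_of_ne (R := ℂ) (V := X) hxy
  exact separated_by_continuous (continuous_dual_polynomialSpace ℓ) hℓ

theorem isClosed_closedBall_polynomialSpace (r : ℝ) :
    IsClosed (X := PolynomialSpace X) (closedBall (0 : X) r : Set X) := by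
  have : closedBall (0 : X) r = ⋂ ℓ : {ℓ : X →L[ℂ] ℂ // ‖ℓ‖ ≤ 1}, {x | ‖ℓ.1 x‖ ≤ r} := by
    ext x
    simp only [mem_closedBall_zero_iff, mem_iInter, mem_ofPred_eq]
    refine ⟨fun hx ℓ => ?_, fun hx => ?_⟩
    · have := ℓ.1.le_of_opNorm_le ℓ.2 x
      linarith
    · obtain ⟨ℓ, hℓ, hx'⟩ := exists_dual_vector'' ℂ x
      have := hx ⟨ℓ, hℓ⟩
      rw [hx'] at this
      simpa using this
  rw [this]
  exact isClosed_iInter fun ℓ =>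
    isClosed_le (continuous_dual_polynomialSpace ℓ.1).norm continuous_const

/-- Holomorphic functions of bounded type are `σ(X, 𝒫(X))`-continuous on smaller balls, as uniform
limits of polynomials there. -/
theorem continuousOn_polynomialSpace_of_differentiableOn {f : X → ℂ}
    (hf : DifferentiableOn ℂ f (ball 0 1))
    (hb : ∀ s < 1, ∃ M : ℝ, ∀ x, ‖x‖ ≤ s → ‖f x‖ ≤ M) {r : ℝ} (hr : r < 1) :
    ContinuousOn (X := PolynomialSpace X) f (closedBall (0 : X) r : Set X) := by
  refine continuousOn_of_uniform_approx_of_continuousOn (α := PolynomialSpace X) fun u hu => ?_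
  obtain ⟨ε, hε, hεu⟩ := Metric.mem_uniformity_dist.1 hu
  -- The approximation is available on balls of positive radius only.
  obtain ⟨r', hr', hr'1⟩ := exists_between (max_lt hr one_pos)
  obtain ⟨s, hs, hs1⟩ := exists_between hr'1
  obtain ⟨M, hM⟩ := hb s hs1
  obtain ⟨P, hP, hPf⟩ := exists_continuousPolynomial_near hf ((le_max_right _ _).trans_lt hr') hs
    hs1 hM hε
  refine ⟨P, (continuous_of_mem_continuousPolynomials hP).continuousOn, fun y hy => ?_⟩
  refine hεu ?_
  rw [dist_eq_norm]
  have hyr : ‖(show X from y)‖ ≤ r := mem_closedBall_zero_iff.1 hy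
  exact hPf y (hyr.trans ((le_max_left _ _).trans hr'.le))

end PolynomialTopology

/-! ### The space of holomorphic functions of bounded type on the ball -/

section BoundedType

variable {X : Type*} [NormedAddCommGroup X] [NormedSpace ℂ X]

theorem isUBounded_setOf_norm_le {r : ℝ} (hr : r < 1) :
    IsUBounded {x : unitBall X | ‖(x : X)‖ ≤ r} :=
  (isUBounded_unitBall_iff _).2 ⟨max r 0, le_max_right _ _, max_lt hr one_pos, fun _ hx =>
    le_max_of_le_left hx⟩

theorem isUBounded_singleton (x : unitBall X) : IsUBounded {x} :=
  (isUBounded_unitBall_iff _).2 ⟨‖(x : X)‖, norm_nonneg _, mem_ball_zero_iff.1 x.2, by simp⟩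

theorem directedOn_isUBounded :
    DirectedOn (· ⊆ ·) {A : Set (unitBall X) | IsUBounded A} := by
  intro A hA B hB
  obtain ⟨r, -, hr, hrA⟩ := (isUBounded_unitBall_iff A).1 hA
  obtain ⟨s, -, hs, hsB⟩ := (isUBounded_unitBall_iff B).1 hB
  exact ⟨_, isUBounded_setOf_norm_le (max_lt hr hs), fun x hx => le_max_of_le_left (hrA x hx),
    fun x hx => le_max_of_le_right (hsB x hx)⟩

namespace Hb

/-- Evaluation at a point of the ball. -/
def eval (x : unitBall X) : Hb (unitBall X) →ₗ[ℂ] ℂ where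
  toFun F := UniformOnFun.toFun {A : Set (unitBall X) | IsUBounded A} F.1 x
  map_add' _ _ := rfl
  map_smul' _ _ := rfl

@[ext] theorem ext_eval {F G : Hb (unitBall X)} (h : ∀ x, eval x F = eval x G) : F = G :=
  Subtype.ext (funext h)

theorem exists_norm_eval_le (F : Hb (unitBall X)) {A : Set (unitBall X)} (hA : IsUBounded A) :
    ∃ C, ∀ x ∈ A, ‖eval x F‖ ≤ C := by
  obtain ⟨C, hC⟩ := isBounded_iff_forall_norm_le.1 (F.2.2 A hA)
  exact ⟨C, fun x hx => hC _ (mem_image_of_mem _ hx)⟩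

/-- A function on the ball that is holomorphic of bounded type, as an element of `H_b(B_X)`. -/
noncomputable def of (f : unitBall X → ℂ) (hf : IsHolomorphic f)
    (hb : ∀ A : Set (unitBall X), IsUBounded A → ∃ C, ∀ x ∈ A, ‖f x‖ ≤ C) : Hb (unitBall X) :=
  ⟨UniformOnFun.ofFun _ f, hf, fun A hA => by
    obtain ⟨C, hC⟩ := hb A hA
    refine isBounded_iff_forall_norm_le.2 ⟨C, ?_⟩
    rintro _ ⟨x, hx, rfl⟩
    exact hC x hx⟩

theorem tendsto_iff {ι : Type*} {l : Filter ι} {F : ι → Hb (unitBall X)} {G : Hb (unitBall X)} :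
    Tendsto F l (𝓝 G) ↔ ∀ A : Set (unitBall X), IsUBounded A →
      TendstoUniformlyOn (fun i x => eval x (F i)) (fun x => eval x G) l A := by
  rw [tendsto_subtype_rng, UniformOnFun.tendsto_iff_tendstoUniformlyOn]
  rfl

theorem continuous_eval (x : unitBall X) : Continuous (eval x) :=
  continuous_iff_continuousAt.2 fun F =>
    (tendsto_iff.1 (tendsto_id (x := 𝓝 F)) _ (isUBounded_singleton x)).tendsto_at (mem_singleton x)

theorem hasBasis_nhds_zero :
    (𝓝 (0 : Hb (unitBall X))).HasBasis
      (fun p : Set (unitBall X) × ℝ => IsUBounded p.1 ∧ 0 < p.2)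
      fun p => {F | ∀ x ∈ p.1, ‖eval x F‖ < p.2} := by
  have h := UniformOnFun.hasBasis_nhds_zero_of_basis {A : Set (unitBall X) | IsUBounded A}
    ⟨_, isUBounded_setOf_norm_le one_half_lt_one⟩ directedOn_isUBounded
    (Metric.nhds_basis_ball (x := (0 : ℂ)))
  have h' := h.comap (Subtype.val : Hb (unitBall X) → _)
  rw [nhds_subtype]
  simp only [mem_ball_zero_iff] at h'
  exact h'

instance : T2Space (Hb (unitBall X)) :=
  ⟨fun F G hFG => by
    obtain ⟨x, hx⟩ : ∃ x, eval x F ≠ eval x G := by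
      by_contra! h
      exact hFG (ext_eval h)
    exact separated_by_continuous (continuous_eval x) hx⟩

/-- A family in `H_b(B_X)` that is uniformly bounded on `B_X`-bounded sets has a pointwise limit in
`H_b(B_X)` along each ultrafilter. -/
theorem exists_tendsto_eval {ι : Type*} (l : Ultrafilter ι) {F : ι → Hb (unitBall X)}
    (hF : ∀ A : Set (unitBall X), IsUBounded A → ∃ C, ∀ i, ∀ x ∈ A, ‖eval x (F i)‖ ≤ C) :
    ∃ G : Hb (unitBall X), ∀ x, Tendsto (fun i => eval x (F i)) l (𝓝 (eval x G)) := by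
  have hlim : ∀ x, ∃ a, Tendsto (fun i => eval x (F i)) l (𝓝 a) := fun x => by
    obtain ⟨C, hC⟩ := hF _ (isUBounded_singleton x)
    obtain ⟨a, -, ha⟩ := exists_tendsto_of_norm_le l (fun i => hC i x rfl)
    exact ⟨a, ha⟩
  choose h hh using hlim
  choose g hg hgF using fun i => (F i).2.1
  classical
  let H : X → ℂ := fun y => if hy : y ∈ unitBall X then h ⟨y, hy⟩ else 0
  have hHh : ∀ x : unitBall X, H x = h x := fun x => dif_pos x.2
  refine ⟨of h ⟨H, fun x hx => ?_, hHh⟩ fun A hA => ?_, hh⟩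
  · refine DifferentiableAt.differentiableWithinAt ?_
    have hx1 : ‖x‖ < 1 := mem_ball_zero_iff.1 hx
    set ρ := (1 - ‖x‖) / 2 with hρ'
    have hρ : 0 < ρ := by rw [hρ']; linarith
    have hnorm : ∀ y ∈ Metric.ball x ρ, ‖y‖ ≤ ‖x‖ + ρ := fun y hy => by
      rw [Metric.mem_ball, dist_eq_norm] at hy
      have := norm_sub_norm_le y x
      linarith
    have hlt : ‖x‖ + ρ < 1 := by rw [hρ']; linarith
    have hsub : Metric.ball x ρ ⊆ unitBall X := fun y hy =>
      mem_ball_zero_iff.2 ((hnorm y hy).trans_lt hlt)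
    obtain ⟨C, hC⟩ := hF _ (isUBounded_setOf_norm_le hlt)
    refine differentiableAt_of_tendsto_ultrafilter l (G := g) (C := C) hρ
      (fun i => (hg i).mono hsub) (fun i y hy => ?_) fun y hy => ?_
    · rw [hgF i ⟨y, hsub hy⟩]
      exact hC i ⟨y, hsub hy⟩ (hnorm y hy)
    · rw [hHh ⟨y, hsub hy⟩]
      exact (hh ⟨y, hsub hy⟩).congr fun i => (hgF i ⟨y, hsub hy⟩).symm
  · obtain ⟨C, hC⟩ := hF A hA
    exact ⟨C, fun x hx =>
      le_of_tendsto (hh x).norm (Eventually.of_forall fun i => hC i x hx)⟩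

/-- A sequence converging in the topology of uniform convergence on `B_X`-bounded sets is uniformly
bounded on each of these sets. -/
theorem exists_norm_eval_le_of_tendstoUniformlyOn {F : ℕ → Hb (unitBall X)} {g : unitBall X → ℂ}
    {A : Set (unitBall X)} (hA : IsUBounded A)
    (h : TendstoUniformlyOn (fun n x => eval x (F n)) g atTop A) :
    ∃ C, ∀ n, ∀ x ∈ A, ‖eval x (F n)‖ ≤ C := by
  obtain ⟨m, hm⟩ := eventually_atTop.1 (Metric.tendstoUniformlyOn_iff.1 h 1 one_pos)
  choose c hc using fun n => exists_norm_eval_le (F n) hA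
  refine ⟨∑ n ∈ Finset.range (m + 1), |c n| + 2, fun n x hx => ?_⟩
  have hle : ∀ k ≤ m, ‖eval x (F k)‖ ≤ ∑ n ∈ Finset.range (m + 1), |c n| := fun k hk =>
    ((hc k x hx).trans (le_abs_self _)).trans (Finset.single_le_sum (f := fun n => |c n|)
      (fun _ _ => abs_nonneg _) (Finset.mem_range.2 (by omega)))
  rcases le_total n m with hn | hn
  · linarith [hle n hn]
  · have h1 := hm n hn x hx
    have h2 := hm m le_rfl x hx
    have h3 : dist (eval x (F n)) (eval x (F m)) < 2 := by
      have := dist_triangle_left (eval x (F n)) (eval x (F m)) (g x)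
      linarith
    rw [dist_eq_norm] at h3
    have := norm_sub_norm_le (eval x (F n)) (eval x (F m))
    linarith [hle m le_rfl]

theorem isCountablyGenerated_uniformity :
    (uniformity (unitBall X →ᵤ[{A : Set (unitBall X) | IsUBounded A}] ℂ)).IsCountablyGenerated := by
  refine UniformOnFun.isCountablyGenerated_uniformity _
    (t := fun n : ℕ => {x : unitBall X | ‖(x : X)‖ ≤ 1 - 1 / (n + 1)})
    (fun n => isUBounded_setOf_norm_le (sub_lt_self _ Nat.one_div_pos_of_nat))
    (fun m n hmn x hx => le_trans (b := 1 - 1 / ((m : ℝ) + 1)) hx (by gcongr)) fun A hA => ?_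
  obtain ⟨r, -, hr1, hr⟩ := (isUBounded_unitBall_iff A).1 hA
  obtain ⟨n, hn⟩ := exists_nat_one_div_lt (sub_pos.2 hr1)
  exact ⟨n, fun x hx => (hr x hx).trans (by linarith)⟩

instance : (uniformity (Hb (unitBall X))).IsCountablyGenerated :=
  have := isCountablyGenerated_uniformity (X := X)
  Filter.comap.isCountablyGenerated _ _

/-- `H_b(B_X)` is closed in the complete space of all functions: a limit in the topology of uniform
convergence on `B_X`-bounded sets is in particular a pointwise limit of a bounded sequence. -/
instance : CompleteSpace (Hb (unitBall X)) := by
  have := isCountablyGenerated_uniformity (X := X)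
  refine (IsSeqClosed.isClosed (s := (Hb (unitBall X) :
    Set (unitBall X →ᵤ[{A : Set (unitBall X) | IsUBounded A}] ℂ))) fun F G hF hFG =>
      ?_).isComplete.completeSpace_coe
  rw [UniformOnFun.tendsto_iff_tendstoUniformlyOn] at hFG
  let F' : ℕ → Hb (unitBall X) := fun n => ⟨F n, hF n⟩
  have hF' : ∀ A : Set (unitBall X), IsUBounded A →
      TendstoUniformlyOn (fun n x => eval x (F' n)) (UniformOnFun.toFun _ G) atTop A := hFG
  obtain ⟨G', hG'⟩ := exists_tendsto_eval (hyperfilter ℕ) (F := F') fun A hA =>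
    exists_norm_eval_le_of_tendstoUniformlyOn hA (hF' A hA)
  have : G = G'.1 := funext fun x => tendsto_nhds_unique
    (((hF' _ (isUBounded_singleton x)).tendsto_at (mem_singleton x)).mono_left
      Nat.hyperfilter_le_atTop) (hG' x)
  rw [this]
  exact G'.2

instance : IsUniformAddGroup (Hb (unitBall X)) := (Hb (unitBall X)).toAddSubgroup.isUniformAddGroup

instance : ContinuousConstSMul ℂ (Hb (unitBall X)) :=
  ⟨fun c => continuous_iff_continuousAt.2 fun F => tendsto_iff.2 fun A hA =>
    (uniformContinuous_const_smul c).comp_tendstoUniformlyOn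
      (tendsto_iff.1 (tendsto_id (x := 𝓝 F)) A hA)⟩

/-- The powers of a continuous linear form on `X`, as elements of `H_b(B_X)`. -/
noncomputable def dualPow (ℓ : X →L[ℂ] ℂ) (m : ℕ) : Hb (unitBall X) :=
  of (fun x => ℓ x ^ m) ⟨fun x => ℓ x ^ m, (ℓ.differentiable.pow m).differentiableOn, fun _ => rfl⟩
    fun A _ => ⟨‖ℓ‖ ^ m, fun x _ => by
      rw [norm_pow]
      refine pow_le_pow_left₀ (norm_nonneg _) ((ℓ.le_opNorm x).trans ?_) m
      exact mul_le_of_le_one_right (norm_nonneg _) (mem_ball_zero_iff.1 x.2).le⟩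

@[simp] theorem eval_dualPow (ℓ : X →L[ℂ] ℂ) (m : ℕ) (x : unitBall X) :
    eval x (dualPow ℓ m) = ℓ x ^ m := rfl

end Hb

end BoundedType

/-! ### Stable orbits and power boundedness -/

section CompositionOperators

theorem HasUStableOrbits.exists_forall_iterate_mem {X : Type*} [NormedAddCommGroup X]
    {φ : unitBall X → unitBall X} (hst : HasUStableOrbits φ) {A : Set (unitBall X)}
    (hA : IsUBounded A) :
    ∃ L : Set (unitBall X), IsUBounded L ∧ ∀ n, ∀ x ∈ A, φ^[n] x ∈ L := by
  obtain ⟨L, hL, h⟩ := hst A hA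
  exact ⟨L, hL, fun n x hx => h n (mem_image_of_mem _ hx)⟩

variable {X : Type*} [NormedAddCommGroup X] [NormedSpace ℂ X] {φ : unitBall X → unitBall X}
  {hφ : IsHolomorphic (fun x => (φ x : X))}

theorem eval_compositionOperator (F : Hb (unitBall X)) (x : unitBall X) :
    Hb.eval x (compositionOperator φ hφ F) = Hb.eval (φ x) F := rfl

theorem eval_compositionOperator_pow (n : ℕ) (F : Hb (unitBall X)) (x : unitBall X) :
    Hb.eval x ((compositionOperator φ hφ ^ n) F) = Hb.eval (φ^[n] x) F := by
  induction n generalizing F with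
  | zero => rfl
  | succ n ih =>
    rw [pow_succ, mul_apply_eq_comp, ih, eval_compositionOperator,
      Function.iterate_succ_apply']

theorem eval_cesaroMean (n : ℕ) (F : Hb (unitBall X)) (x : unitBall X) :
    Hb.eval x (cesaroMean (compositionOperator φ hφ) n F) =
      (n : ℂ)⁻¹ * ∑ k ∈ Finset.range n, Hb.eval (φ^[k] x) F := by
  simp only [cesaroMean, map_smul, map_sum, eval_compositionOperator_pow, smul_eq_mul]

theorem norm_eval_cesaroMean_le (n : ℕ) {F : Hb (unitBall X)} {x : unitBall X} {M : ℝ}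
    (hM : ∀ k, ‖Hb.eval (φ^[k] x) F‖ ≤ M) :
    ‖Hb.eval x (cesaroMean (compositionOperator φ hφ) n F)‖ ≤ M := by
  have hM0 : 0 ≤ M := (norm_nonneg _).trans (hM 0)
  rcases n.eq_zero_or_pos with rfl | hn
  · simpa [eval_cesaroMean] using hM0
  have hn' : (0 : ℝ) < n := Nat.cast_pos.2 hn
  rw [eval_cesaroMean, norm_mul, norm_inv, Complex.norm_natCast, inv_mul_le_iff₀ hn']
  simpa using norm_sum_le_of_le (Finset.range n) fun k _ => hM k

/-- A family of linear operators on `H_b(B_X)` is equicontinuous if the sup norm on each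
`B_X`-bounded set `A` of the images is controlled, uniformly in the family, by the sup norm on one
`B_X`-bounded set `L`. -/
theorem Hb.equicontinuous_of_norm_eval_le {ι : Type*}
    (S : ι → Hb (unitBall X) →ₗ[ℂ] Hb (unitBall X))
    (h : ∀ A : Set (unitBall X), IsUBounded A → ∃ L : Set (unitBall X), IsUBounded L ∧
      ∀ i F M, (∀ y ∈ L, ‖Hb.eval y F‖ ≤ M) → ∀ x ∈ A, ‖Hb.eval x (S i F)‖ ≤ M) :
    Equicontinuous fun i F => S i F := by
  refine equicontinuous_of_equicontinuousAt_zero S fun U hU => ?_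
  rw [uniformity_eq_comap_nhds_zero, Filter.mem_comap] at hU
  obtain ⟨V, hV, hVU⟩ := hU
  obtain ⟨⟨A, ε⟩, ⟨hA, hε⟩, hAV⟩ := Hb.hasBasis_nhds_zero.mem_iff.1 hV
  obtain ⟨L, hL, hLA⟩ := h A hA
  filter_upwards [Hb.hasBasis_nhds_zero.mem_of_mem (i := (L, ε / 2)) ⟨hL, half_pos hε⟩]
    with F hF i
  refine hVU (hAV ?_)
  intro x hx
  simp only [Function.comp_apply, map_zero, sub_zero]
  exact (hLA i F (ε / 2) (fun y hy => (hF y hy).le) x hx).trans_lt (half_lt_self hε)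

theorem HasUStableOrbits.isPowerBounded (hst : HasUStableOrbits φ) :
    IsPowerBounded (compositionOperator φ hφ) := by
  refine Hb.equicontinuous_of_norm_eval_le
    (fun n => ((compositionOperator φ hφ ^ n : Hb (unitBall X) →L[ℂ] Hb (unitBall X)) :
      Hb (unitBall X) →ₗ[ℂ] Hb (unitBall X))) fun A hA => ?_
  obtain ⟨L, hL, h⟩ := hst.exists_forall_iterate_mem hA
  refine ⟨L, hL, fun n F M hM x hx => ?_⟩
  rw [ContinuousLinearMap.coe_coe, eval_compositionOperator_pow]
  exact hM _ (h n x hx)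

/-- If evaluation at all the points `φ^n(x)`, `x ∈ A`, is bounded on a neighbourhood of zero by a
constant that may depend on `n`, then the orbits of `A` stay in one `B_X`-bounded set.

On powers `ℓ^m` of linear forms the bounds read `|ℓ(φ^n(x))|^m ≤ c_n R^m` with `R < 1` independent
of `n`; the `m`-th root removes the constants `c_n`. -/
theorem exists_isUBounded_of_bound_on_nhds_zero {A : Set (unitBall X)} {V : Set (Hb (unitBall X))}
    (hV : V ∈ 𝓝 0) {N : ℕ → ℝ}
    (hN : ∀ F ∈ V, ∀ n, ∀ x ∈ A, ‖Hb.eval (φ^[n] x) F‖ ≤ N n) :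
    ∃ L : Set (unitBall X), IsUBounded L ∧ ∀ n, φ^[n] '' A ⊆ L := by
  obtain ⟨⟨B, ε⟩, ⟨hB, hε⟩, hBV⟩ := Hb.hasBasis_nhds_zero.mem_iff.1 hV
  obtain ⟨r, -, hr1, hr⟩ := (isUBounded_unitBall_iff B).1 hB
  obtain ⟨R, hR, hR1⟩ := exists_between (max_lt hr1 one_pos)
  have hR0 : 0 < R := (le_max_right _ _).trans_lt hR
  refine ⟨_, isUBounded_setOf_norm_le hR1, fun n => ?_⟩
  rintro _ ⟨x, hx, rfl⟩
  obtain ⟨ℓ, hℓ, hℓy⟩ := exists_dual_vector'' ℂ (φ^[n] x : X)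
  have hbound : ∀ m : ℕ, ε / 2 * (‖(φ^[n] x : X)‖ / R) ^ m ≤ N n := fun m => by
    let c : ℂ := ((ε / 2 / R ^ m : ℝ) : ℂ)
    have hc : ‖c‖ = ε / 2 / R ^ m := by
      rw [Complex.norm_real, Real.norm_of_nonneg (by positivity)]
    have hmem : c • Hb.dualPow ℓ m ∈ V := hBV fun z hz => by
      rw [map_smul, norm_smul, hc, Hb.eval_dualPow, norm_pow]
      have hz' : ‖ℓ z‖ ≤ R := calc
        ‖ℓ z‖ ≤ 1 * ‖(z : X)‖ := ℓ.le_of_opNorm_le hℓ _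
        _ ≤ R := by
          rw [one_mul]
          exact (hr z hz).trans ((le_max_left _ _).trans hR.le)
      calc ε / 2 / R ^ m * ‖ℓ z‖ ^ m ≤ ε / 2 / R ^ m * R ^ m := by gcongr
        _ = ε / 2 := by field_simp
        _ < ε := half_lt_self hε
    have := hN _ hmem n x hx
    rw [map_smul, norm_smul, hc, Hb.eval_dualPow, norm_pow, hℓy] at this
    refine le_trans (le_of_eq ?_) this
    simp only [RCLike.norm_ofReal, abs_norm, div_pow]
    ring
  by_contra hcon
  have h1 : 1 < ‖(φ^[n] x : X)‖ / R := (one_lt_div hR0).2 (not_le.1 hcon)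
  obtain ⟨m, hm⟩ := (((tendsto_pow_atTop_atTop_of_one_lt h1).const_mul_atTop
    (half_pos hε)).eventually_gt_atTop (N n)).exists
  exact (hbound m).not_gt hm

theorem HasUStableOrbits.of_isPowerBounded (h : IsPowerBounded (compositionOperator φ hφ)) :
    HasUStableOrbits φ := by
  intro A hA
  have hW : {F : Hb (unitBall X) | ∀ x ∈ A, ‖Hb.eval x F‖ < 1} ∈ 𝓝 0 :=
    Hb.hasBasis_nhds_zero.mem_of_mem (i := (A, 1)) ⟨hA, one_pos⟩
  have hev := h 0 _ (by
    rw [uniformity_eq_comap_nhds_zero]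
    exact preimage_mem_comap hW)
  refine exists_isUBounded_of_bound_on_nhds_zero hev (N := fun _ => 1) fun F hF n x hx => ?_
  have := hF n x hx
  simp only [map_zero, sub_zero, eval_compositionOperator_pow] at this
  exact this.le

/-- Mean ergodicity gives `T^n F = O(n)` for each `F`; by the Baire category theorem in `H_b(B_X)`
this bound is uniform on a neighbourhood of zero. -/
theorem HasUStableOrbits.of_isMeanErgodic (h : IsMeanErgodic (compositionOperator φ hφ)) :
    HasUStableOrbits φ := by
  intro A hA
  obtain ⟨P, hP⟩ := h
  let E : ℕ → Set (Hb (unitBall X)) := fun N =>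
    {F | ∀ n : ℕ, ∀ x ∈ A, ‖Hb.eval (φ^[n] x) F‖ ≤ N * (n + 1)}
  have hEc : ∀ N, IsClosed (E N) := fun N => by
    simp only [E, ofPred_forall]
    exact isClosed_iInter fun n => isClosed_iInter fun x => isClosed_iInter fun _ =>
      isClosed_le (Hb.continuous_eval _).norm continuous_const
  have hEu : ⋃ N, E N = univ := by
    refine eq_univ_of_forall fun F => ?_
    obtain ⟨C, hC⟩ := Hb.exists_norm_eval_le_of_tendstoUniformlyOn hA
      (Hb.tendsto_iff.1 (hP F) A hA)
    obtain ⟨N, hN⟩ := exists_nat_ge (2 * C)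
    refine mem_iUnion.2 ⟨N, fun n x hx => ?_⟩
    have hsum : ∀ n : ℕ, ‖∑ k ∈ Finset.range n, Hb.eval (φ^[k] x) F‖ ≤ n * C := fun n => by
      rcases n.eq_zero_or_pos with rfl | hn
      · simp
      have hn' : (0 : ℝ) < n := Nat.cast_pos.2 hn
      have := hC n x hx
      rwa [eval_cesaroMean, norm_mul, norm_inv, Complex.norm_natCast,
        inv_mul_le_iff₀ hn'] at this
    have h1 := hsum (n + 1)
    have h2 := hsum n
    have h3 : Hb.eval (φ^[n] x) F = ∑ k ∈ Finset.range (n + 1), Hb.eval (φ^[k] x) F -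
        ∑ k ∈ Finset.range n, Hb.eval (φ^[k] x) F := by
      rw [Finset.sum_range_succ]; ring
    have hC0 : 0 ≤ C := (norm_nonneg _).trans (hC 0 x hx)
    have hn0 : (0 : ℝ) ≤ n := n.cast_nonneg
    rw [h3]
    refine (norm_sub_le _ _).trans ?_
    push_cast at h1
    nlinarith
  obtain ⟨N, F₀, hF₀⟩ := nonempty_interior_of_iUnion_of_closed hEc hEu
  have hV : {F | F₀ + F ∈ E N} ∈ 𝓝 (0 : Hb (unitBall X)) := by
    have hc : Continuous fun F : Hb (unitBall X) => F₀ + F := continuous_const.add continuous_id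
    refine hc.continuousAt.preimage_mem_nhds ?_
    rw [add_zero]
    exact mem_interior_iff_mem_nhds.1 hF₀
  refine exists_isUBounded_of_bound_on_nhds_zero hV (N := fun n => 2 * (N * (n + 1)))
    fun F hF n x hx => ?_
  have h1 := hF n x hx
  have h2 := interior_subset hF₀ n x hx
  rw [map_add] at h1
  have h3 := norm_sub_le (Hb.eval (φ^[n] x) F₀ + Hb.eval (φ^[n] x) F) (Hb.eval (φ^[n] x) F₀)
  rw [add_sub_cancel_left] at h3
  linarith

end CompositionOperators

/-! ### Convergence of the Cesàro means -/

section CesaroMeans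

variable {X : Type*} [NormedAddCommGroup X] [NormedSpace ℂ X] {φ : unitBall X → unitBall X}
  {hφ : IsHolomorphic (fun x => (φ x : X))}

/-- The `n`-th Cesàro mean as a linear map. -/
noncomputable def cesaroLinearMap {E : Type*} [AddCommGroup E] [Module ℂ E] [TopologicalSpace E]
    (T : E →L[ℂ] E) (n : ℕ) : E →ₗ[ℂ] E where
  toFun := cesaroMean T n
  map_add' x y := by simp [cesaroMean, Finset.sum_add_distrib]
  map_smul' c x := by simp [cesaroMean, Finset.smul_sum, smul_comm c]

theorem cesaroLinearMap_apply {E : Type*} [AddCommGroup E] [Module ℂ E] [TopologicalSpace E]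
    (T : E →L[ℂ] E) (n : ℕ) (x : E) : cesaroLinearMap T n x = cesaroMean T n x := rfl

/-- For stable orbits the Cesàro means are equicontinuous, so that their pointwise limit, if it
exists, is continuous. -/
theorem HasUStableOrbits.isMeanErgodic_of_tendsto (hst : HasUStableOrbits φ)
    (h : ∀ F, ∃ H, Tendsto (fun n => cesaroMean (compositionOperator φ hφ) n F) atTop (𝓝 H)) :
    IsMeanErgodic (compositionOperator φ hφ) := by
  choose P hP using h
  have hlim : Tendsto (fun n F => cesaroLinearMap (compositionOperator φ hφ) n F) atTop (𝓝 P) :=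
    tendsto_pi_nhds.2 hP
  have heq : Equicontinuous fun n F => cesaroLinearMap (compositionOperator φ hφ) n F := by
    refine Hb.equicontinuous_of_norm_eval_le _ fun A hA => ?_
    obtain ⟨L, hL, h⟩ := hst.exists_forall_iterate_mem hA
    exact ⟨L, hL, fun n F M hM x hx => norm_eval_cesaroMean_le n fun k => hM _ (h k x hx)⟩
  exact ⟨⟨linearMapOfTendsto P _ hlim, hlim.continuous_of_equicontinuous heq⟩, hP⟩

theorem cesaroMean_compositionOperator (n : ℕ) (F : Hb (unitBall X)) (x : unitBall X) :
    Hb.eval x (cesaroMean (compositionOperator φ hφ) n (compositionOperator φ hφ F)) =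
      Hb.eval (φ x) (cesaroMean (compositionOperator φ hφ) n F) := by
  simp only [eval_cesaroMean, eval_compositionOperator, ← Function.iterate_succ_apply,
    ← Function.iterate_succ_apply']

/-- The Cesàro means of `F - T F` telescope to `(F - T^n F) / n`. -/
theorem HasUStableOrbits.tendsto_cesaroMean_sub (hst : HasUStableOrbits φ) (F : Hb (unitBall X)) :
    Tendsto (fun n => cesaroLinearMap (compositionOperator φ hφ) n
      (F - compositionOperator φ hφ F)) atTop (𝓝 0) := by
  rw [Hb.tendsto_iff]
  intro A hA
  obtain ⟨L, hL, h⟩ := hst.exists_forall_iterate_mem hA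
  obtain ⟨C, hC⟩ := Hb.exists_norm_eval_le F hL
  rw [Metric.tendstoUniformlyOn_iff]
  intro ε hε
  have hlim : Tendsto (fun n : ℕ => (n : ℝ)⁻¹ * (C + C)) atTop (𝓝 0) := by
    simpa using tendsto_inv_atTop_nhds_zero_nat.mul_const (C + C)
  filter_upwards [hlim.eventually_lt_const hε] with n hn x hx
  rw [map_zero, dist_zero_left, cesaroLinearMap_apply, eval_cesaroMean, norm_mul, norm_inv,
    Complex.norm_natCast]
  refine lt_of_le_of_lt ?_ hn
  gcongr
  have : ∀ k, Hb.eval (φ^[k] x) (F - compositionOperator φ hφ F) =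
      Hb.eval (φ^[k] x) F - Hb.eval (φ^[k + 1] x) F := fun k => by
    rw [map_sub, eval_compositionOperator, Function.iterate_succ_apply']
  rw [Finset.sum_congr rfl fun k _ => this k, Finset.sum_range_sub']
  exact (norm_sub_le _ _).trans (add_le_add (hC _ (h 0 x hx)) (hC _ (h n x hx)))

/-- `G` has asymptotically the same Cesàro means as `F`: those of `F - G` tend to `0`. -/
def SameCesaroLimit (T : Hb (unitBall X) →L[ℂ] Hb (unitBall X)) (F G : Hb (unitBall X)) : Prop :=
  Tendsto (fun n => cesaroLinearMap T n (F - G)) atTop (𝓝 0)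

theorem HasUStableOrbits.sameCesaroLimit_apply (hst : HasUStableOrbits φ) {F G : Hb (unitBall X)}
    (h : SameCesaroLimit (compositionOperator φ hφ) F G) :
    SameCesaroLimit (compositionOperator φ hφ) F (compositionOperator φ hφ G) := by
  have := h.add (hst.tendsto_cesaroMean_sub (hφ := hφ) G)
  simp only [← map_add, sub_add_sub_cancel, add_zero] at this
  exact this

theorem HasUStableOrbits.sameCesaroLimit_pow (hst : HasUStableOrbits φ) (F : Hb (unitBall X))
    (k : ℕ) : SameCesaroLimit (compositionOperator φ hφ) F ((compositionOperator φ hφ ^ k) F) := by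
  induction k with
  | zero =>
    simp [SameCesaroLimit]
  | succ k ih =>
    rw [pow_succ', mul_apply_eq_comp]
    exact hst.sameCesaroLimit_apply ih

theorem SameCesaroLimit.sum {T : Hb (unitBall X) →L[ℂ] Hb (unitBall X)} {F : Hb (unitBall X)}
    {ι : Type*} {s : Finset ι} {w : ι → ℂ} {G : ι → Hb (unitBall X)} (hw : ∑ k ∈ s, w k = 1)
    (h : ∀ k ∈ s, SameCesaroLimit T F (G k)) : SameCesaroLimit T F (∑ k ∈ s, w k • G k) := by
  have heq : F - ∑ k ∈ s, w k • G k = ∑ k ∈ s, w k • (F - G k) := by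
    simp only [smul_sub, Finset.sum_sub_distrib, ← Finset.sum_smul, hw, one_smul]
  have := tendsto_finsetSum s fun k hk => (h k hk).const_smul (w k)
  simp only [smul_zero, Finset.sum_const_zero, ← map_smul, ← map_sum] at this
  rw [SameCesaroLimit, heq]
  exact this

theorem HasUStableOrbits.sameCesaroLimit_cesaroMean (hst : HasUStableOrbits φ)
    (F : Hb (unitBall X)) (n : ℕ) : SameCesaroLimit (compositionOperator φ hφ) F
      (cesaroMean (compositionOperator φ hφ) (n + 1) F) := by
  rw [cesaroMean, Finset.smul_sum]
  refine SameCesaroLimit.sum ?_ fun k _ => hst.sameCesaroLimit_pow F k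
  rw [Finset.sum_const, Finset.card_range, nsmul_eq_mul, mul_inv_cancel₀]
  exact_mod_cast n.succ_ne_zero

/-- A fixed point `H` of `T` that is approximated by functions with asymptotically the same Cesàro
means as `F` is the limit of the Cesàro means of `F`. -/
theorem HasUStableOrbits.tendsto_cesaroMean (hst : HasUStableOrbits φ) {F H : Hb (unitBall X)}
    (hH : ∀ x, Hb.eval (φ x) H = Hb.eval x H)
    (happ : ∀ A : Set (unitBall X), IsUBounded A → ∀ ε > 0, ∃ G,
      SameCesaroLimit (compositionOperator φ hφ) F G ∧
        ∀ x ∈ A, ‖Hb.eval x G - Hb.eval x H‖ < ε) :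
    Tendsto (fun n => cesaroMean (compositionOperator φ hφ) n F) atTop (𝓝 H) := by
  rw [Hb.tendsto_iff]
  intro A hA
  rw [Metric.tendstoUniformlyOn_iff]
  intro ε hε
  obtain ⟨L, hL, h⟩ := hst.exists_forall_iterate_mem hA
  obtain ⟨G, hFG, hG⟩ := happ L hL (ε / 2) (half_pos hε)
  have hiter : ∀ k x, Hb.eval (φ^[k] x) H = Hb.eval x H := fun k x => by
    induction k with
    | zero => rfl
    | succ k ih => rw [Function.iterate_succ_apply', hH, ih]
  filter_upwards [Metric.tendstoUniformlyOn_iff.1 (Hb.tendsto_iff.1 hFG A hA) (ε / 2)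
    (half_pos hε), eventually_ge_atTop 1] with n hn hn1 x hx
  have h1 := hn x hx
  rw [map_zero, dist_zero_left] at h1
  have h2 : ‖Hb.eval x (cesaroLinearMap (compositionOperator φ hφ) n (G - H))‖ ≤ ε / 2 :=
    norm_eval_cesaroMean_le n fun k => by
      rw [map_sub]
      exact (hG _ (h k x hx)).le
  have h3 : Hb.eval x (cesaroLinearMap (compositionOperator φ hφ) n H) = Hb.eval x H := by
    have hn0 : (n : ℂ) ≠ 0 := Nat.cast_ne_zero.2 (by omega)
    rw [cesaroLinearMap_apply, eval_cesaroMean, Finset.sum_congr rfl fun k _ => hiter k x]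
    simp [hn0]
  have h4 : Hb.eval x (cesaroMean (compositionOperator φ hφ) n F) - Hb.eval x H =
      Hb.eval x (cesaroLinearMap (compositionOperator φ hφ) n (F - G)) +
        Hb.eval x (cesaroLinearMap (compositionOperator φ hφ) n (G - H)) := by
    rw [← map_add, ← map_add, sub_add_sub_cancel, map_sub, map_sub, h3, cesaroLinearMap_apply]
  rw [dist_comm, dist_eq_norm, h4]
  linarith [norm_add_le (Hb.eval x (cesaroLinearMap (compositionOperator φ hφ) n (F - G)))
    (Hb.eval x (cesaroLinearMap (compositionOperator φ hφ) n (G - H)))]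

/-- On a relatively `σ(X, 𝒫(X))`-compact `B_X`-bounded set, an ultrafilter limit of a sequence that
is bounded in `H_b(B_X)` is uniformly approximated by convex combinations of the sequence. -/
theorem exists_convexCombination_near_of_isRelativelyPolynomialCompact
    {B : Set (unitBall X)} (hB : IsUBounded B)
    (hBc : IsRelativelyPolynomialCompact (Subtype.val '' B)) {a : ℕ → Hb (unitBall X)}
    (ha : ∀ A : Set (unitBall X), IsUBounded A → ∃ C, ∀ n, ∀ x ∈ A, ‖Hb.eval x (a n)‖ ≤ C)
    (V : Ultrafilter ℕ) {H : Hb (unitBall X)}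
    (hH : ∀ x, Tendsto (fun n => Hb.eval x (a n)) V (𝓝 (Hb.eval x H))) {ε : ℝ} (hε : 0 < ε) :
    ∃ (s : Finset ℕ) (w : ℕ → ℂ) (n : ℕ → ℕ), ∑ k ∈ s, w k = 1 ∧
      ∀ x ∈ B, ‖Hb.eval x (∑ k ∈ s, w k • a (n k)) - Hb.eval x H‖ < ε := by
  obtain ⟨r, -, hr1, hr⟩ := (isUBounded_unitBall_iff B).1 hB
  let K : Set (PolynomialSpace X) := closure (X := PolynomialSpace X) (Subtype.val '' B)
  have hK : ∀ y ∈ K, ‖(show X from y)‖ ≤ r := fun y hy => by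
    refine mem_closedBall_zero_iff.1 (closure_minimal (X := PolynomialSpace X) ?_
      (isClosed_closedBall_polynomialSpace r) hy)
    rintro _ ⟨x, hx, rfl⟩
    exact mem_closedBall_zero_iff.2 (hr x hx)
  have : CompactSpace K := isCompact_iff_compactSpace.1 hBc
  let p : K → unitBall X := fun y => ⟨y.1, mem_ball_zero_iff.2 ((hK y.1 y.2).trans_lt hr1)⟩
  have hcont : ∀ F : Hb (unitBall X), Continuous fun y => Hb.eval (p y) F := fun F => by
    obtain ⟨g, hg, hgF⟩ := F.2.1
    have h1 := continuousOn_polynomialSpace_of_differentiableOn hg (fun s hs => by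
      obtain ⟨C, hC⟩ := Hb.exists_norm_eval_le F (isUBounded_setOf_norm_le hs)
      refine ⟨C, fun x hx => ?_⟩
      rw [hgF ⟨x, mem_ball_zero_iff.2 (hx.trans_lt hs)⟩]
      exact hC ⟨x, mem_ball_zero_iff.2 (hx.trans_lt hs)⟩ hx) hr1
    have h2 := continuousOn_iff_continuous_domRestrict.1
      (h1.mono fun y hy => mem_closedBall_zero_iff.2 (hK y hy))
    exact h2.congr fun y => hgF (p y)
  obtain ⟨C, hC⟩ := ha _ (isUBounded_setOf_norm_le hr1)
  obtain ⟨s, w, n, -, hw, hs⟩ := exists_convexCombination_near_ultrafilter_limit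
    (f := fun n y => Hb.eval (p y) (a n)) (fun n => hcont (a n))
    (fun n y => hC n (p y) (hK y.1 y.2)) (fun W g hg => by
      obtain ⟨G, hG⟩ := Hb.exists_tendsto_eval W ha
      have : g = fun y => Hb.eval (p y) G := funext fun y => tendsto_nhds_unique (hg y) (hG (p y))
      rw [this]
      exact hcont G) V (fun y => hH (p y)) hε
  refine ⟨s, fun k => w k, n, by rw [← Complex.ofReal_sum, hw, Complex.ofReal_one], fun x hx => ?_⟩
  simp only [map_sum, map_smul, smul_eq_mul]
  exact hs ⟨(x : X), subset_closure (X := PolynomialSpace X) (mem_image_of_mem _ hx)⟩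

/-- Composition operators with stable orbits and relatively `σ(X, 𝒫(X))`-compact images of
`B_X`-bounded sets are mean ergodic: an ultrafilter limit of the Cesàro means is a fixed point, and
it is approximated by convex combinations of the means. -/
theorem HasUStableOrbits.isMeanErgodic (hst : HasUStableOrbits φ)
    (hc : ∀ A : Set (unitBall X), IsUBounded A →
      IsRelativelyPolynomialCompact ((fun x => (φ x : X)) '' A)) :
    IsMeanErgodic (compositionOperator φ hφ) := by
  refine hst.isMeanErgodic_of_tendsto fun F => ?_
  -- The means of order `0` vanish and are skipped.
  let a : ℕ → Hb (unitBall X) := fun n => cesaroMean (compositionOperator φ hφ) (n + 1) F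
  have ha : ∀ A : Set (unitBall X), IsUBounded A → ∃ C, ∀ n, ∀ x ∈ A, ‖Hb.eval x (a n)‖ ≤ C := by
    intro A hA
    obtain ⟨L, hL, h⟩ := hst.exists_forall_iterate_mem hA
    obtain ⟨C, hC⟩ := Hb.exists_norm_eval_le F hL
    exact ⟨C, fun n x hx => norm_eval_cesaroMean_le _ fun k => hC _ (h k x hx)⟩
  obtain ⟨H, hH⟩ := Hb.exists_tendsto_eval (hyperfilter ℕ) ha
  have hfix : ∀ x, Hb.eval (φ x) H = Hb.eval x H := fun x => by
    have h1 := ((Hb.continuous_eval x).tendsto _).comp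
      ((hst.tendsto_cesaroMean_sub (hφ := hφ) F).comp (tendsto_add_atTop_nat 1))
    have h2 := tendsto_nhds_unique ((hH x).sub (hH (φ x))) ((h1.mono_left
      Nat.hyperfilter_le_atTop).congr fun n => by
        simp only [Function.comp_apply, map_sub, cesaroLinearMap_apply,
          cesaroMean_compositionOperator, a])
    rw [map_zero] at h2
    exact (sub_eq_zero.1 h2).symm
  refine ⟨H, hst.tendsto_cesaroMean hfix fun A hA ε hε => ?_⟩
  -- Compactness is available on `φ(A)`, so the combinations are composed with `φ` once more.
  obtain ⟨s, w, n, hw, hs⟩ := exists_convexCombination_near_of_isRelativelyPolynomialCompact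
    (hA.image_of_holomorphic hφ) (by rw [image_image]; exact hc A hA) ha (hyperfilter ℕ) hH hε
  refine ⟨compositionOperator φ hφ (∑ k ∈ s, w k • a (n k)), hst.sameCesaroLimit_apply
    (SameCesaroLimit.sum hw fun k _ => hst.sameCesaroLimit_cesaroMean F _), fun x hx => ?_⟩
  rw [eval_compositionOperator, ← hfix x]
  exact hs _ (mem_image_of_mem _ hx)

end CesaroMeans

theorem mainTheorem8 {X : Type*} [NormedAddCommGroup X] [NormedSpace ℂ X] [CompleteSpace X] :
    (∀ (φ : unitBall X → unitBall X) (hφ : IsHolomorphic (fun x => (φ x : X))),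
      HasUStableOrbits φ →
      (∀ A : Set (unitBall X), IsUBounded A →
        IsRelativelyPolynomialCompact ((fun x => (φ x : X)) '' A)) →
      IsMeanErgodic (compositionOperator φ hφ)) ∧
    ((∀ A : Set (unitBall X), IsUBounded A →
        IsRelativelyPolynomialCompact (Subtype.val '' A)) →
      ∀ (φ : unitBall X → unitBall X) (hφ : IsHolomorphic (fun x => (φ x : X))),
        IsPowerBounded (compositionOperator φ hφ) ↔
          IsMeanErgodic (compositionOperator φ hφ)) := by
  refine ⟨fun φ hφ hst hc => hst.isMeanErgodic hc, fun hX φ hφ => ⟨fun h => ?_, fun h => ?_⟩⟩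
  · refine (HasUStableOrbits.of_isPowerBounded h).isMeanErgodic fun A hA => ?_
    have := hX _ (hA.image_of_holomorphic hφ)
    rwa [image_image] at this
  · exact (HasUStableOrbits.of_isMeanErgodic h).isPowerBounded
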